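/- **Setting.** Let $f:\mathbb R^n\to\mathbb R$ be convex and differentiable, let $\psi:\mathbb R^n\to\mathbb R\cup\{+\infty\}$ be proper, closed and convex, and put $F=f+\psi$, $F^\star=\inf F$. Assume that the set $\mathcal X_\star$ of minimizers of $F$ is nonempty. For a vector $v$ with positive entries let $\|x\|_v^2=\sum_i v_i (x^i)^2$, and let $\operatorname{dist}_v(x,\mathcal X_\star)$ be the distance from $x$ to $\mathcal X_\star$ in this norm. Let $x_0\in\operatorname{dom}F$ and assume: 1. $L$ is a vector with positive entries such that $f(x)\le f(y)+\langle\nabla f(y),x-y\rangle+\frac12\|x-y\|_L^2$ for all $x,y$; 2. $\mu_F=\mu_F(L,x_0)>0$ satisfies $F(x)\ge F^\star+\frac{\mu_F}{2}\operatorname{dist}_L(x,\mathcal X_\star)^2$ for all $x$ with $F(x)\le F(x_0)$. Let $T(x)=\arg\min_y\{\langle\nabla f(x),y-x\rangle+\frac12\|y-x\|_L^2+\psi(y)\}$, $\theta_0=1$, $\theta_{k+1}=\frac12\big(\sqrt{\theta_k^4+4\theta_k^2}-\theta_k^2\big)$, and $K(\mu)=\lceil 2\sqrt{e/\mu}-1\rceil$.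 **Accelerated schemes.** For an input $(u,K)$ set $x_0=z_0=u$ and, for $0\le k<K$, $y_k=(1-\theta_k)x_k+\theta_k z_k$. * FISTA: $x_{k+1}=T(y_k)$ and $z_{k+1}=z_k+\frac1{\theta_k}(x_{k+1}-y_k)$. * APG: $z_{k+1}=\arg\min_z\{\langle\nabla f(y_k),z-y_k\rangle+\frac{\theta_k}{2}\|z-z_k\|_L^2+\psi(z)\}$ and $x_{k+1}=y_k+\theta_k(z_{k+1}-z_k)$. The output is $x_K$. **AdaRES**, with parameters $\epsilon>0$ and $\mu_0>0$ such that $K(\mu_0)\ge 1$ (equivalently $\mu_0<4e$). Put $x_{-1,t_{-1}}=x_0$. For $s=0,1,2,\dots$ let $$\mu_s=2^{-s}\mu_0,\qquad K_s=K(\mu_s),\qquad x_{s,0}=T(x_{s-1,t_{s-1}}),\qquad C_s=\frac{16\,\|x_{s,0}-x_{s-1,t_{s-1}}\|_L^2}{\mu_s}.$$ For $t=1,2,\dots$ let $x_{s,t}$ be the output of FISTA or of APG (an arbitrary choice at each call) with input $(x_{s,t-1},K_s)$, and let $t_s$ be the first $t\ge1$ such that $$\|T(x_{s,t})-x_{s,t}\|_L^2>C_s\,(\theta_{K_s-1}^2/\mu_s)^t\quad\text{or}\quad\|T(x_{s,t})-x_{s,t}\|_L^2\le\epsilon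 .$$ The algorithm stops at the first $s=\hat s$ with $\|T(x_{s,t_s})-x_{s,t_s}\|_L^2\le\epsilon$. The number of proximal gradient mappings is $\hat N=1+\sum_{s=0}^{\hat s}(t_sK_s+1)$. **Theorem.** Put $$A=\max\Big\{1,\Big\lceil\ln\frac{2(F(x_0)-F^\star)}{\epsilon}\Big\rceil\Big\},\qquad B=\max\Big\{1,\Big\lceil\ln\frac{32(F(x_0)-F^\star)}{\epsilon\,\mu_F}\Big\rceil\Big\},$$ where the maximum is read as $1$ if $F(x_0)=F^\star$. Then AdaRES terminates, and: * if $\mu_0\le\mu_F$, then $\displaystyle\hat N\le\Big\lceil2\sqrt{\frac e{\mu_0}}-1\Big\rceil A+2$; * if $\mu_0>\mu_F$, then $$\hat N\le1+\Big\lceil\log_2\frac{\mu_0}{\mu_F}\Big\rceil+\frac{2\sqrt e}{\sqrt2-1}\Big(\sqrt{\frac2{\mu_F}}-\sqrt{\frac1{\mu_0}}\Big)B+\Big\lceil\frac{2\sqrt{2e}}{\sqrt{\mu_F}}\Big\rceil A .$$ In particular, if $\epsilon<2(F(x_0)-F^\star)$, then in both bounds the maxima can be omitted, i.e. the factors $A$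 and $B$ that occur are the rounded-up logarithms themselves. -/

import Mathlib

namespace AdaRES

/-- The squared weighted Euclidean norm `‖x‖_v² = ∑ i, v i * (x i)²`. -/
noncomputable def wnormSq {n : ℕ} (v : Fin n → ℝ) (x : EuclideanSpace ℝ (Fin n)) : ℝ :=
  ∑ i, v i * (x i) ^ 2

/-- The weighted Euclidean norm `‖x‖_v`. -/
noncomputable def wnorm {n : ℕ} (v : Fin n → ℝ) (x : EuclideanSpace ℝ (Fin n)) : ℝ :=
  Real.sqrt (wnormSq v x)

/-- The distance from `x` to the set `S` in the norm `‖·‖_v` (used only for nonempty `S`). -/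
noncomputable def wdist {n : ℕ} (v : Fin n → ℝ) (x : EuclideanSpace ℝ (Fin n))
    (S : Set (EuclideanSpace ℝ (Fin n))) : ℝ :=
  sInf ((fun y => wnorm v (x - y)) '' S)

/-- `ψ : ℝⁿ → ℝ ∪ {+∞}` is proper, closed (lower semicontinuous) and convex. -/
structure ProperClosedConvex {n : ℕ} (ψ : EuclideanSpace ℝ (Fin n) → EReal) : Prop where
  ne_bot : ∀ x, ψ x ≠ ⊥
  exists_ne_top : ∃ x, ψ x ≠ ⊤
  lsc : LowerSemicontinuous ψ
  convex_epigraph : Convex ℝ {p : EuclideanSpace ℝ (Fin n) × ℝ | ψ p.1 ≤ (p.2 : EReal)}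

/-- The objective `F = f + ψ`. -/
noncomputable def objective {n : ℕ} (f : EuclideanSpace ℝ (Fin n) → ℝ)
    (ψ : EuclideanSpace ℝ (Fin n) → EReal) (x : EuclideanSpace ℝ (Fin n)) : EReal :=
  (f x : EReal) + ψ x

/-- The optimal value `F⋆`. -/
noncomputable def optValue {n : ℕ} (f : EuclideanSpace ℝ (Fin n) → ℝ)
    (ψ : EuclideanSpace ℝ (Fin n) → EReal) : EReal :=
  ⨅ x, objective f ψ x

/-- The set of optimal solutions `X⋆`. -/
def solutionSet {n : ℕ} (f : EuclideanSpace ℝ (Fin n) → ℝ)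
    (ψ : EuclideanSpace ℝ (Fin n) → EReal) : Set (EuclideanSpace ℝ (Fin n)) :=
  {x | ∀ y, objective f ψ x ≤ objective f ψ y}

/-- `F(x) - F⋆` as a real number (used only where both values are finite). -/
noncomputable def gap {n : ℕ} (f : EuclideanSpace ℝ (Fin n) → ℝ)
    (ψ : EuclideanSpace ℝ (Fin n) → EReal) (x : EuclideanSpace ℝ (Fin n)) : ℝ :=
  (objective f ψ x).toReal - (optValue f ψ).toReal

/-- Smoothness of `f` with respect to the weights `L`:
`f(x) ≤ f(y) + ⟨∇f(y), x - y⟩ + ½‖x - y‖_L²` for all `x, y`. -/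
def IsSmooth {n : ℕ} (f : EuclideanSpace ℝ (Fin n) → ℝ) (L : Fin n → ℝ) : Prop :=
  ∀ x y, f x ≤ f y + inner ℝ (gradient f y) (x - y) + 1 / 2 * wnormSq L (x - y)

/-- The local quadratic error bound with constant `μ` on the sublevel set `[F ≤ F(x₀)]`:
`F(x) ≥ F⋆ + (μ/2) dist_L(x, X⋆)²`. -/
def QuadraticErrorBound {n : ℕ} (f : EuclideanSpace ℝ (Fin n) → ℝ)
    (ψ : EuclideanSpace ℝ (Fin n) → EReal) (L : Fin n → ℝ)
    (x₀ : EuclideanSpace ℝ (Fin n)) (μ : ℝ) : Prop :=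
  ∀ x, objective f ψ x ≤ objective f ψ x₀ →
    optValue f ψ + ((μ / 2 * wdist L x (solutionSet f ψ) ^ 2 : ℝ) : EReal) ≤ objective f ψ x

/-- A minimizer of `g`, if there is one. (The functions minimized below are a proper closed convex
function plus a positive definite quadratic one, so their minimizer exists and is unique.) -/
noncomputable def argmin {n : ℕ} (g : EuclideanSpace ℝ (Fin n) → EReal) :
    EuclideanSpace ℝ (Fin n) :=
  Classical.epsilon fun x => ∀ y, g x ≤ g y

/-- The proximal gradient mapping
`T(x) = argmin_y { ⟨∇f(x), y - x⟩ + ½‖y - x‖_L² + ψ(y) }`. -/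
noncomputable def proxMap {n : ℕ} (f : EuclideanSpace ℝ (Fin n) → ℝ)
    (ψ : EuclideanSpace ℝ (Fin n) → EReal) (L : Fin n → ℝ)
    (x : EuclideanSpace ℝ (Fin n)) : EuclideanSpace ℝ (Fin n) :=
  argmin fun y =>
    ((inner ℝ (gradient f x) (y - x) + 1 / 2 * wnormSq L (y - x) : ℝ) : EReal) + ψ y

/-- `θ₀ = 1`, `θ_{k+1} = (√(θ_k⁴ + 4 θ_k²) - θ_k²) / 2`. -/
noncomputable def theta : ℕ → ℝ
  | 0 => 1
  | k + 1 => (Real.sqrt (theta k ^ 4 + 4 * theta k ^ 2) - theta k ^ 2) / 2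

/-- The pair `(x_k, z_k)` of FISTA started at `x₀`. -/
noncomputable def fistaState {n : ℕ} (f : EuclideanSpace ℝ (Fin n) → ℝ)
    (ψ : EuclideanSpace ℝ (Fin n) → EReal) (L : Fin n → ℝ) (x₀ : EuclideanSpace ℝ (Fin n)) :
    ℕ → EuclideanSpace ℝ (Fin n) × EuclideanSpace ℝ (Fin n)
  | 0 => (x₀, x₀)
  | k + 1 =>
    let x := (fistaState f ψ L x₀ k).1
    let z := (fistaState f ψ L x₀ k).2
    let y := (1 - theta k) • x + theta k • z
    let x' := argmin fun w =>
      ((inner ℝ (gradient f y) (w - y) + 1 / 2 * wnormSq L (w - y) : ℝ) : EReal) + ψ w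
    (x', z + (1 / theta k) • (x' - y))

/-- The pair `(x_k, z_k)` of APG started at `x₀`. -/
noncomputable def apgState {n : ℕ} (f : EuclideanSpace ℝ (Fin n) → ℝ)
    (ψ : EuclideanSpace ℝ (Fin n) → EReal) (L : Fin n → ℝ) (x₀ : EuclideanSpace ℝ (Fin n)) :
    ℕ → EuclideanSpace ℝ (Fin n) × EuclideanSpace ℝ (Fin n)
  | 0 => (x₀, x₀)
  | k + 1 =>
    let x := (apgState f ψ L x₀ k).1
    let z := (apgState f ψ L x₀ k).2
    let y := (1 - theta k) • x + theta k • z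
    let z' := argmin fun w =>
      ((inner ℝ (gradient f y) (w - y) + theta k / 2 * wnormSq L (w - z) : ℝ) : EReal) + ψ w
    (y + theta k • (z' - z), z')

/-- The two accelerated schemes that may be restarted. -/
inductive Scheme
  | fista
  | apg

/-- The output `x_K` of the scheme with input `(x₀, K)`. -/
noncomputable def Scheme.run {n : ℕ} (f : EuclideanSpace ℝ (Fin n) → ℝ)
    (ψ : EuclideanSpace ℝ (Fin n) → EReal) (L : Fin n → ℝ) (m : Scheme)
    (x₀ : EuclideanSpace ℝ (Fin n)) (K : ℕ) : EuclideanSpace ℝ (Fin n) :=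
  match m with
  | .fista => (fistaState f ψ L x₀ K).1
  | .apg => (apgState f ψ L x₀ K).1

/-- The restart period `K(μ) = ⌈2√(e/μ) - 1⌉`. -/
noncomputable def restartPeriod (μ : ℝ) : ℕ :=
  ⌈2 * Real.sqrt (Real.exp 1 / μ) - 1⌉₊

/-- The estimates `μ_s`: the initial estimate `μ₀`, halved after each pass of the outer loop. -/
noncomputable def estimate (μ₀ : ℝ) : ℕ → ℝ
  | 0 => μ₀
  | s + 1 => estimate μ₀ s / 2

/-- A complete (terminating) execution of AdaRES from `x₀` with parameters `ε` and `μ₀`, where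
`m s τ` is the scheme used in the call number `τ` of pass `s` of the outer loop. -/
structure Execution {n : ℕ} (f : EuclideanSpace ℝ (Fin n) → ℝ)
    (ψ : EuclideanSpace ℝ (Fin n) → EReal) (L : Fin n → ℝ) (m : ℕ → ℕ → Scheme)
    (ε μ₀ : ℝ) (x₀ : EuclideanSpace ℝ (Fin n)) where
  /-- the index `ŝ` of the last pass of the outer loop -/
  sHat : ℕ
  /-- `t s` is the number `t_s` of calls made in pass `s` -/
  t : ℕ → ℕ
  /-- `x s τ` is the iterate `x_{s,τ}` -/
  x : ℕ → ℕ → EuclideanSpace ℝ (Fin n)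
  /-- `prev s` is the point `x_{s-1,t_{s-1}}`, which is `x₀` for `s = 0` -/
  prev : ℕ → EuclideanSpace ℝ (Fin n)
  prev_zero : prev 0 = x₀
  prev_succ : ∀ s ≤ sHat, prev (s + 1) = x s (t s)
  start : ∀ s ≤ sHat, x s 0 = proxMap f ψ L (prev s)
  call : ∀ s ≤ sHat, ∀ τ < t s,
    x s (τ + 1) = (m s τ).run f ψ L (x s τ) (restartPeriod (estimate μ₀ s))
  /-- the inner `repeat ... until` loop runs at least once -/
  inner_pos : ∀ s ≤ sHat, 1 ≤ t s
  /-- the exit test of the inner loop holds after `t s` calls, with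
  `C_s = 16 ‖x_{s,0} - x_{s-1,t_{s-1}}‖_L² / μ_s` -/
  inner_exit : ∀ s ≤ sHat,
    16 * wnormSq L (x s 0 - prev s) / estimate μ₀ s *
        (theta (restartPeriod (estimate μ₀ s) - 1) ^ 2 / estimate μ₀ s) ^ t s
      < wnormSq L (proxMap f ψ L (x s (t s)) - x s (t s)) ∨
    wnormSq L (proxMap f ψ L (x s (t s)) - x s (t s)) ≤ ε
  /-- the exit test of the inner loop fails before that -/
  inner_continue : ∀ s ≤ sHat, ∀ τ, 1 ≤ τ → τ < t s →
    ¬ (16 * wnormSq L (x s 0 - prev s) / estimate μ₀ s *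
          (theta (restartPeriod (estimate μ₀ s) - 1) ^ 2 / estimate μ₀ s) ^ τ
        < wnormSq L (proxMap f ψ L (x s τ) - x s τ) ∨
      wnormSq L (proxMap f ψ L (x s τ) - x s τ) ≤ ε)
  /-- the stopping test of the outer loop holds after pass `ŝ` -/
  outer_exit : wnormSq L (proxMap f ψ L (x sHat (t sHat)) - x sHat (t sHat)) ≤ ε
  /-- the stopping test of the outer loop fails before that -/
  outer_continue : ∀ s < sHat, ¬ wnormSq L (proxMap f ψ L (x s (t s)) - x s (t s)) ≤ ε

/-- The number of proximal gradient mappings `N̂ = 1 + ∑_{s ≤ ŝ} (t_s K_s + 1)`. -/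
noncomputable def Execution.numSteps {n : ℕ} {f : EuclideanSpace ℝ (Fin n) → ℝ}
    {ψ : EuclideanSpace ℝ (Fin n) → EReal} {L : Fin n → ℝ} {m : ℕ → ℕ → Scheme}
    {ε μ₀ : ℝ} {x₀ : EuclideanSpace ℝ (Fin n)} (R : Execution f ψ L m ε μ₀ x₀) : ℕ :=
  1 + ∑ s ∈ Finset.range (R.sHat + 1), (R.t s * restartPeriod (estimate μ₀ s) + 1)

end AdaRES

/-! Write r(x) = ‖T(x) - x‖_L² and q_s = θ_{K_s-1}²/μ_s, and call F - F⋆ the gap. Three estimates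
carry the proof.

Descent: r(x) ≤ 2 gap(x) on the domain of ψ (`wnormSq_proxMap_sub_le_gap`).

Acceleration: F(x_K) - F(u) ≤ (θ_{K-1}²/2) ‖x₀ - u‖_L² for every u in the domain (`run_bound`). The
choice u = x₀ shows that a call never increases F, so all iterates stay in the sublevel set where
the error bound is assumed. With u a solution, the error bound turns this into contraction of the
gap by q_s whenever μ_s ≤ μ_F, and K_s is chosen so that q_s ≤ 1/e (`theta_sq_div_le`).

Converse: gap(T(x)) ≤ 8 r(x)/μ under quadratic growth at T(x) (`gap_proxMap_le_of_growth`).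

If μ_s ≤ μ_F and pass s starts at p, then after t calls the residual is at most 2 q_s^t gap(T(p)) ≤
C_s q_s^t. The first exit test cannot hold, so the pass ends with residual at most ε and is the last
one; it needs at most A calls because 2 e^{-t} gap(x₀) ≤ ε by then. Thus ŝ is at most the least j
with μ_j ≤ μ_F.

Whatever μ_s is, a pass ends once C_s q_s^t ≤ ε, since one of the two exit tests must then hold. As
C_s ≤ 32 gap(x₀)/μ_s, at most B calls are made when μ_s ≥ μ_F. The periods of the passes before j
are bounded by a geometric series of ratio √2. -/

namespace AdaRES

open Filter Topology

/-! ### Weighted norms and distances -/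

section WeightedNorm

variable {n : ℕ} {v : Fin n → ℝ}

lemma wnormSq_nonneg (hv : ∀ i, 0 < v i) (x : EuclideanSpace ℝ (Fin n)) : 0 ≤ wnormSq v x :=
  Finset.sum_nonneg fun i _ => mul_nonneg (hv i).le (sq_nonneg _)

@[simp] lemma wnormSq_zero : wnormSq v 0 = 0 := by simp [wnormSq]

lemma wnormSq_smul (c : ℝ) (x : EuclideanSpace ℝ (Fin n)) :
    wnormSq v (c • x) = c ^ 2 * wnormSq v x := by
  simp only [wnormSq, Finset.mul_sum]
  refine Finset.sum_congr rfl fun i _ => ?_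
  simp only [PiLp.smul_apply, smul_eq_mul]
  ring

lemma wnormSq_sub_comm (x y : EuclideanSpace ℝ (Fin n)) :
    wnormSq v (x - y) = wnormSq v (y - x) := by
  rw [← neg_sub, ← neg_one_smul ℝ, wnormSq_smul]
  ring

lemma wnormSq_add_smul_sub (p u z : EuclideanSpace ℝ (Fin n)) (t : ℝ) :
    wnormSq v (p + t • (u - p) - z) =
      (1 - t) * wnormSq v (p - z) + t * wnormSq v (u - z) - t * (1 - t) * wnormSq v (u - p) := by
  simp only [wnormSq, Finset.mul_sum, ← Finset.sum_add_distrib, ← Finset.sum_sub_distrib]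
  refine Finset.sum_congr rfl fun i _ => ?_
  simp only [PiLp.smul_apply, smul_eq_mul, PiLp.add_apply, PiLp.sub_apply]
  ring

lemma exists_pos_mul_norm_sq_le_wnormSq (hv : ∀ i, 0 < v i) :
    ∃ c > 0, ∀ x : EuclideanSpace ℝ (Fin n), c * ‖x‖ ^ 2 ≤ wnormSq v x := by
  obtain ⟨c, hc, hcv⟩ : ∃ c > 0, ∀ i, c ≤ v i := by
    rcases isEmpty_or_nonempty (Fin n) with h | h
    · exact ⟨1, one_pos, fun i => h.elim i⟩
    · obtain ⟨i, hi⟩ := Finite.exists_min v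
      exact ⟨v i, hv i, hi⟩
  refine ⟨c, hc, fun x => ?_⟩
  rw [EuclideanSpace.real_norm_sq_eq, Finset.mul_sum]
  exact Finset.sum_le_sum fun i _ => mul_le_mul_of_nonneg_right (hcv i) (sq_nonneg _)

lemma continuous_wnormSq : Continuous (wnormSq v) := by
  unfold wnormSq
  fun_prop

/-- A bound at every point of `S` passes to the infimum, so no nearest point has to exist. -/
lemma le_mul_wdist_sq {S : Set (EuclideanSpace ℝ (Fin n))} (hS : S.Nonempty) {a c : ℝ}
    (hc : 0 < c) {x : EuclideanSpace ℝ (Fin n)} (h : ∀ y ∈ S, a ≤ c * wnormSq v (x - y)) :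
    a ≤ c * wdist v x S ^ 2 := by
  rcases le_or_gt a 0 with ha | ha
  · exact ha.trans (by positivity)
  have hle : Real.sqrt (a / c) ≤ wdist v x S := by
    refine le_csInf (hS.image _) ?_
    rintro _ ⟨y, hy, rfl⟩
    exact Real.sqrt_le_sqrt ((div_le_iff₀' hc).2 (h y hy))
  have := (Real.sqrt_le_left ((Real.sqrt_nonneg _).trans hle)).1 hle
  exact (div_le_iff₀' hc).1 this

end WeightedNorm

/-- Let `t → 0`. Such inequalities arise on comparing a minimizer with the points of a segment and
dividing by `t`. -/
lemma add_le_of_forall_add_one_sub_mul_le {a b c : ℝ}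
    (h : ∀ t, 0 < t → t < 1 → a + (1 - t) * b ≤ c) : a + b ≤ c := by
  have hlim : Tendsto (fun t : ℝ => a + (1 - t) * b) (𝓝[>] 0) (𝓝 (a + b)) := by
    have : Continuous fun t : ℝ => a + (1 - t) * b := by fun_prop
    simpa using (this.tendsto 0).mono_left nhdsWithin_le_nhds
  refine le_of_tendsto hlim ?_
  filter_upwards [Ioo_mem_nhdsGT (zero_lt_one (α := ℝ))] with t ht using h t ht.1 ht.2

/-! ### The gradient inequality for convex functions -/

section FirstOrder

variable {E : Type*} [NormedAddCommGroup E] [InnerProductSpace ℝ E] [CompleteSpace E]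

lemma inner_gradient_le_sub {f : E → ℝ} (hf : Differentiable ℝ f) (hc : ConvexOn ℝ Set.univ f)
    (x y : E) : f x + inner ℝ (gradient f x) (y - x) ≤ f y := by
  have hconv : ConvexOn ℝ Set.univ (f ∘ AffineMap.lineMap (k := ℝ) x y) := by
    simpa using hc.comp_affineMap (AffineMap.lineMap (k := ℝ) x y)
  have hderiv : HasDerivAt (f ∘ AffineMap.lineMap (k := ℝ) x y)
      (inner ℝ (gradient f x) (y - x)) 0 := by
    have h1 : HasFDerivAt f ((InnerProductSpace.toDual ℝ E) (gradient f x))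
        (AffineMap.lineMap x y (0 : ℝ)) := by
      simpa using (hf x).hasGradientAt.hasFDerivAt
    simpa using h1.comp_hasDerivAt (0 : ℝ) AffineMap.hasDerivAt_lineMap
  have := hconv.le_slope_of_hasDerivAt (Set.mem_univ 0) (Set.mem_univ 1) zero_lt_one hderiv
  simp only [slope_def_field, Function.comp_apply, AffineMap.lineMap_apply_zero,
    AffineMap.lineMap_apply_one, sub_zero, div_one] at this
  linarith

end FirstOrder

/-! ### Effective domain and real-valued objective -/

variable {n : ℕ}

/-- The effective domain of an extended real valued function. -/
def effDom (ψ : EuclideanSpace ℝ (Fin n) → EReal) : Set (EuclideanSpace ℝ (Fin n)) :=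
  {x | ψ x ≠ ⊤}

lemma ProperClosedConvex.coe_toReal {ψ : EuclideanSpace ℝ (Fin n) → EReal}
    (hψ : ProperClosedConvex ψ) {x : EuclideanSpace ℝ (Fin n)} (hx : x ∈ effDom ψ) :
    ((ψ x).toReal : EReal) = ψ x :=
  EReal.coe_toReal hx (hψ.ne_bot x)

lemma ProperClosedConvex.convexOn {ψ : EuclideanSpace ℝ (Fin n) → EReal}
    (hψ : ProperClosedConvex ψ) : ConvexOn ℝ (effDom ψ) fun x => (ψ x).toReal := by
  have key : ∀ ⦃x⦄, x ∈ effDom ψ → ∀ ⦃y⦄, y ∈ effDom ψ → ∀ ⦃a b : ℝ⦄, 0 ≤ a → 0 ≤ b → a + b = 1 →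
      ψ (a • x + b • y) ≤ ((a * (ψ x).toReal + b * (ψ y).toReal : ℝ) : EReal) := by
    intro x hx y hy a b ha hb hab
    have h := hψ.convex_epigraph (x := (x, (ψ x).toReal)) (hψ.coe_toReal hx).ge
      (y := (y, (ψ y).toReal)) (hψ.coe_toReal hy).ge ha hb hab
    simpa using h
  have hmem : ∀ ⦃x⦄, x ∈ effDom ψ → ∀ ⦃y⦄, y ∈ effDom ψ → ∀ ⦃a b : ℝ⦄, 0 ≤ a → 0 ≤ b →
      a + b = 1 → a • x + b • y ∈ effDom ψ := fun x hx y hy a b ha hb hab =>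
    ne_top_of_le_ne_top (EReal.coe_ne_top _) (key hx hy ha hb hab)
  refine ⟨hmem, fun x hx y hy a b ha hb hab => ?_⟩
  have h := key hx hy ha hb hab
  rw [← hψ.coe_toReal (hmem hx hy ha hb hab)] at h
  exact EReal.coe_le_coe_iff.1 h

/-- The real valued objective, meaningful on the effective domain of `ψ`. -/
noncomputable def realObjective (f : EuclideanSpace ℝ (Fin n) → ℝ)
    (ψ : EuclideanSpace ℝ (Fin n) → EReal) (x : EuclideanSpace ℝ (Fin n)) : ℝ :=
  f x + (ψ x).toReal

/-- The standing assumptions on a composite convex problem. -/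
structure IsComposite (f : EuclideanSpace ℝ (Fin n) → ℝ)
    (ψ : EuclideanSpace ℝ (Fin n) → EReal) (L : Fin n → ℝ) : Prop where
  differentiable : Differentiable ℝ f
  convex : ConvexOn ℝ Set.univ f
  proper : ProperClosedConvex ψ
  nonempty : (solutionSet f ψ).Nonempty
  pos : ∀ i, 0 < L i
  smooth : IsSmooth f L

namespace IsComposite

variable {f : EuclideanSpace ℝ (Fin n) → ℝ} {ψ : EuclideanSpace ℝ (Fin n) → EReal} {L : Fin n → ℝ}

lemma objective_eq (H : IsComposite f ψ L) {x : EuclideanSpace ℝ (Fin n)} (hx : x ∈ effDom ψ) :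
    objective f ψ x = (realObjective f ψ x : EReal) := by
  rw [objective, realObjective, EReal.coe_add, H.proper.coe_toReal hx]

lemma mem_effDom_of_objective_ne_top {x : EuclideanSpace ℝ (Fin n)}
    (hx : objective f ψ x ≠ ⊤) : x ∈ effDom ψ := fun h => hx (by simp [objective, h])

lemma solution_mem (H : IsComposite f ψ L) {x : EuclideanSpace ℝ (Fin n)}
    (hx : x ∈ solutionSet f ψ) : x ∈ effDom ψ := by
  obtain ⟨y, hy⟩ := H.proper.exists_ne_top
  refine mem_effDom_of_objective_ne_top (f := f) (ne_top_of_le_ne_top ?_ (hx y))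
  rw [H.objective_eq hy]
  exact EReal.coe_ne_top _

lemma solution_le (H : IsComposite f ψ L) {x y : EuclideanSpace ℝ (Fin n)}
    (hx : x ∈ solutionSet f ψ) (hy : y ∈ effDom ψ) :
    realObjective f ψ x ≤ realObjective f ψ y := by
  have h := hx y
  rwa [H.objective_eq hy, H.objective_eq (H.solution_mem hx), EReal.coe_le_coe_iff] at h

lemma optValue_eq (H : IsComposite f ψ L) {x : EuclideanSpace ℝ (Fin n)}
    (hx : x ∈ solutionSet f ψ) : optValue f ψ = (realObjective f ψ x : EReal) := by
  rw [← H.objective_eq (H.solution_mem hx)]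
  exact le_antisymm (iInf_le _ x) (le_iInf hx)

lemma gap_eq (H : IsComposite f ψ L) {x y : EuclideanSpace ℝ (Fin n)}
    (hx : x ∈ solutionSet f ψ) (hy : y ∈ effDom ψ) :
    gap f ψ y = realObjective f ψ y - realObjective f ψ x := by
  rw [gap, H.optValue_eq hx, H.objective_eq hy, EReal.toReal_coe, EReal.toReal_coe]

lemma gap_nonneg (H : IsComposite f ψ L) {y : EuclideanSpace ℝ (Fin n)} (hy : y ∈ effDom ψ) :
    0 ≤ gap f ψ y := by
  obtain ⟨x, hx⟩ := H.nonempty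
  rw [H.gap_eq hx hy]
  exact sub_nonneg.2 (H.solution_le hx hy)

lemma gap_sub_gap (H : IsComposite f ψ L) {x y : EuclideanSpace ℝ (Fin n)} (hx : x ∈ effDom ψ)
    (hy : y ∈ effDom ψ) :
    gap f ψ x - gap f ψ y = realObjective f ψ x - realObjective f ψ y := by
  obtain ⟨z, hz⟩ := H.nonempty
  rw [H.gap_eq hz hx, H.gap_eq hz hy]
  ring

lemma lineMap_mem (H : IsComposite f ψ L) {p u : EuclideanSpace ℝ (Fin n)} (hp : p ∈ effDom ψ)
    (hu : u ∈ effDom ψ) {t : ℝ} (h0 : 0 ≤ t) (h1 : t ≤ 1) : p + t • (u - p) ∈ effDom ψ := by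
  have : p + t • (u - p) = (1 - t) • p + t • u := by module
  rw [this]
  exact H.proper.convexOn.1 hp hu (sub_nonneg.2 h1) h0 (by ring)

lemma toReal_lineMap_le (H : IsComposite f ψ L) {p u : EuclideanSpace ℝ (Fin n)}
    (hp : p ∈ effDom ψ) (hu : u ∈ effDom ψ) {t : ℝ} (h0 : 0 ≤ t) (h1 : t ≤ 1) :
    (ψ (p + t • (u - p))).toReal ≤ (1 - t) * (ψ p).toReal + t * (ψ u).toReal := by
  have : p + t • (u - p) = (1 - t) • p + t • u := by module
  rw [this]
  exact H.proper.convexOn.2 hp hu (sub_nonneg.2 h1) h0 (by ring)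

lemma realObjective_lineMap_le (H : IsComposite f ψ L) {p u : EuclideanSpace ℝ (Fin n)}
    (hp : p ∈ effDom ψ) (hu : u ∈ effDom ψ) {t : ℝ} (h0 : 0 ≤ t) (h1 : t ≤ 1) :
    realObjective f ψ (p + t • (u - p)) ≤
      (1 - t) * realObjective f ψ p + t * realObjective f ψ u := by
  have hψ := H.toReal_lineMap_le hp hu h0 h1
  have hf := H.convex.2 (Set.mem_univ p) (Set.mem_univ u) (sub_nonneg.2 h1) h0 (by ring)
  have : (1 - t) • p + t • u = p + t • (u - p) := by module
  rw [this] at hf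
  simp only [smul_eq_mul] at hf
  simp only [realObjective]
  linarith

/-- Optimality of a solution gives an affine minorant of `ψ`. -/
lemma affine_minorant (H : IsComposite f ψ L) {p u : EuclideanSpace ℝ (Fin n)}
    (hp : p ∈ solutionSet f ψ) (hu : u ∈ effDom ψ) :
    (ψ p).toReal - inner ℝ (gradient f p) (u - p) ≤ (ψ u).toReal := by
  have hpD := H.solution_mem hp
  -- The smoothness remainder `t / 2 * wnormSq L (u - p)`, left after division by `t`, is split so
  -- that it vanishes in the limit.
  have h : ∀ t, 0 < t → t < 1 →
      ((ψ p).toReal - inner ℝ (gradient f p) (u - p) - 1 / 2 * wnormSq L (u - p)) +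
        (1 - t) * (1 / 2 * wnormSq L (u - p)) ≤ (ψ u).toReal := by
    intro t h0 h1
    have hmin := H.solution_le hp (H.lineMap_mem hpD hu h0.le h1.le)
    have hψ := H.toReal_lineMap_le hpD hu h0.le h1.le
    have hf := H.smooth (p + t • (u - p)) p
    rw [add_sub_cancel_left, wnormSq_smul, real_inner_smul_right] at hf
    simp only [realObjective] at hmin
    refine le_of_mul_le_mul_left ?_ h0
    nlinarith
  have := add_le_of_forall_add_one_sub_mul_le h
  linarith

/-! ### Proximal subproblems -/

/-- The value at `w` of the real part of a proximal subproblem. -/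
noncomputable def proxModel (L : Fin n → ℝ) (c : ℝ) (g y z w : EuclideanSpace ℝ (Fin n)) : ℝ :=
  inner ℝ g (w - y) + c / 2 * wnormSq L (w - z)

lemma proxModel_lineMap (c : ℝ) (g y z p u : EuclideanSpace ℝ (Fin n)) (t : ℝ) :
    proxModel L c g y z (p + t • (u - p)) = (1 - t) * proxModel L c g y z p +
      t * proxModel L c g y z u - c / 2 * (t * (1 - t) * wnormSq L (u - p)) := by
  have : p + t • (u - p) - y = (1 - t) • (p - y) + t • (u - y) := by module
  rw [proxModel, proxModel, proxModel, wnormSq_add_smul_sub, this, inner_add_right,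
    real_inner_smul_right, real_inner_smul_right]
  ring

lemma norm_le_of_mul_sq_le {a b c r : ℝ} (ha : 0 < a) (hb : 0 ≤ b) (h : a * r ^ 2 ≤ c + b * r) :
    r ≤ 1 + (|c| + b) / a := by
  rcases le_or_gt r 1 with hr | hr
  · have : 0 ≤ (|c| + b) / a := by positivity
    linarith
  have : r ≤ (|c| + b) / a := by
    rw [le_div_iff₀ ha]
    have hc : c ≤ |c| * r := (le_abs_self c).trans (by nlinarith [abs_nonneg c])
    refine le_of_mul_le_mul_right ?_ (zero_lt_one.trans hr)
    nlinarith
  linarith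

/-- The affine minorant of `ψ` at a solution `s` is dominated by the quadratic term, so the sublevel
set at the value of `s` lies in a ball, where lower semicontinuity gives a minimizer. -/
lemma exists_proxMin (H : IsComposite f ψ L) {c : ℝ} (hc : 0 < c)
    (g y z : EuclideanSpace ℝ (Fin n)) :
    ∃ p, ∀ w, (proxModel L c g y z p : EReal) + ψ p ≤ (proxModel L c g y z w : EReal) + ψ w := by
  obtain ⟨s, hs⟩ := H.nonempty
  have hsD := H.solution_mem hs
  obtain ⟨a, ha, haL⟩ := exists_pos_mul_norm_sq_le_wnormSq H.pos
  set M : ℝ := proxModel L c g y z s + (ψ s).toReal with hM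
  set d : ℝ := M - (ψ s).toReal - inner ℝ g (z - y) + inner ℝ (gradient f s) (z - s) with hd
  set R : ℝ := 1 + (|d| + ‖gradient f s - g‖) / (c / 2 * a) with hR
  have hbound : ∀ w, (proxModel L c g y z w : EReal) + ψ w ≤ (M : EReal) →
      w ∈ Metric.closedBall z R := by
    intro w hw
    have hwD : w ∈ effDom ψ := by
      intro h
      rw [h, EReal.coe_add_top] at hw
      exact EReal.coe_ne_top M (top_le_iff.1 hw)
    rw [← H.proper.coe_toReal hwD, ← EReal.coe_add, EReal.coe_le_coe_iff, proxModel] at hw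
    have hmin := H.affine_minorant hs hwD
    rw [mem_closedBall_iff_norm]
    refine norm_le_of_mul_sq_le (by positivity) (norm_nonneg _) ?_
    have hq := haL (w - z)
    have hcs := real_inner_le_norm (gradient f s - g) (w - z)
    rw [inner_sub_left] at hcs
    have e1 : w - y = (w - z) + (z - y) := by abel
    have e2 : w - s = (w - z) + (z - s) := by abel
    rw [e1, inner_add_right] at hw
    rw [e2, inner_add_right] at hmin
    have := mul_le_mul_of_nonneg_left hq (half_pos hc).le
    linarith
  have hlsc : LowerSemicontinuous fun w => (proxModel L c g y z w : EReal) + ψ w := by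
    refine LowerSemicontinuous.add' ?_ H.proper.lsc fun w =>
      EReal.continuousAt_add (Or.inl (EReal.coe_ne_top _)) (Or.inl (EReal.coe_ne_bot _))
    refine (continuous_coe_real_ereal.comp ?_).lowerSemicontinuous
    have := continuous_wnormSq (v := L)
    unfold proxModel
    fun_prop
  have hsM : (proxModel L c g y z s : EReal) + ψ s ≤ (M : EReal) := by
    rw [hM, EReal.coe_add, H.proper.coe_toReal hsD]
  obtain ⟨p, -, hp⟩ := LowerSemicontinuousOn.exists_isMinOn ⟨s, hbound s hsM⟩
    (isCompact_closedBall z R) (hlsc.lowerSemicontinuousOn _)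
  refine ⟨p, fun w => ?_⟩
  rcases le_total ((proxModel L c g y z w : EReal) + ψ w) (M : EReal) with hw | hw
  · exact hp (hbound w hw)
  · exact ((hp (hbound s hsM)).trans hsM).trans hw

/-- The three point inequality for the minimizer of a proximal subproblem. -/
lemma argmin_three_point (H : IsComposite f ψ L) {c : ℝ} (hc : 0 < c)
    (g y z : EuclideanSpace ℝ (Fin n)) {p : EuclideanSpace ℝ (Fin n)}
    (hpdef : p = argmin fun w => (proxModel L c g y z w : EReal) + ψ w) :
    p ∈ effDom ψ ∧ ∀ u ∈ effDom ψ,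
      proxModel L c g y z p + (ψ p).toReal + c / 2 * wnormSq L (u - p) ≤
        proxModel L c g y z u + (ψ u).toReal := by
  -- Existence suffices to use the choice in `argmin`; the inequality holds for any minimizer, so
  -- uniqueness plays no role.
  have hmin : ∀ w, (proxModel L c g y z p : EReal) + ψ p ≤ (proxModel L c g y z w : EReal) + ψ w :=
    hpdef ▸ Classical.epsilon_spec (H.exists_proxMin hc g y z)
  have hpD : p ∈ effDom ψ := by
    obtain ⟨s, hs⟩ := H.nonempty
    intro h
    have h1 := hmin s
    rw [h, EReal.coe_add_top, ← H.proper.coe_toReal (H.solution_mem hs), ← EReal.coe_add] at h1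
    exact EReal.coe_ne_top _ (top_le_iff.1 h1)
  refine ⟨hpD, fun u hu => add_le_of_forall_add_one_sub_mul_le fun t h0 h1 => ?_⟩
  have hw := hmin (p + t • (u - p))
  rw [← H.proper.coe_toReal hpD, ← H.proper.coe_toReal (H.lineMap_mem hpD hu h0.le h1.le),
    ← EReal.coe_add, ← EReal.coe_add, EReal.coe_le_coe_iff, proxModel_lineMap] at hw
  have hψ := H.toReal_lineMap_le hpD hu h0.le h1.le
  refine le_of_mul_le_mul_left ?_ h0
  linarith

/-! ### Inequalities for the proximal gradient mapping -/

lemma first_order (H : IsComposite f ψ L) (x y : EuclideanSpace ℝ (Fin n)) :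
    f x + inner ℝ (gradient f x) (y - x) ≤ f y :=
  inner_gradient_le_sub H.differentiable H.convex x y

lemma proxMap_three_point (H : IsComposite f ψ L) (x : EuclideanSpace ℝ (Fin n)) :
    proxMap f ψ L x ∈ effDom ψ ∧ ∀ u ∈ effDom ψ,
      inner ℝ (gradient f x) (proxMap f ψ L x - x) + 1 / 2 * wnormSq L (proxMap f ψ L x - x) +
          (ψ (proxMap f ψ L x)).toReal + 1 / 2 * wnormSq L (u - proxMap f ψ L x) ≤
        inner ℝ (gradient f x) (u - x) + 1 / 2 * wnormSq L (u - x) + (ψ u).toReal :=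
  H.argmin_three_point one_pos (gradient f x) x x rfl

lemma proxMap_mem (H : IsComposite f ψ L) (x : EuclideanSpace ℝ (Fin n)) :
    proxMap f ψ L x ∈ effDom ψ := (H.proxMap_three_point x).1

/-- The three point inequality, smoothness at `T(x)` and convexity at `u` add up, and the linear
terms cancel. Taking `u = x` gives descent; taking `u` on a segment gives the FISTA step. -/
lemma realObjective_proxMap_le (H : IsComposite f ψ L) (x : EuclideanSpace ℝ (Fin n))
    {u : EuclideanSpace ℝ (Fin n)} (hu : u ∈ effDom ψ) :
    realObjective f ψ (proxMap f ψ L x) + 1 / 2 * wnormSq L (u - proxMap f ψ L x) ≤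
      realObjective f ψ u + 1 / 2 * wnormSq L (u - x) := by
  have h1 := (H.proxMap_three_point x).2 u hu
  have h2 := H.smooth (proxMap f ψ L x) x
  have h3 := H.first_order x u
  simp only [realObjective]
  linarith

lemma wnormSq_proxMap_sub_le (H : IsComposite f ψ L) {x : EuclideanSpace ℝ (Fin n)}
    (hx : x ∈ effDom ψ) :
    1 / 2 * wnormSq L (proxMap f ψ L x - x) ≤ gap f ψ x - gap f ψ (proxMap f ψ L x) := by
  have h := H.realObjective_proxMap_le x hx
  rw [sub_self, wnormSq_zero, wnormSq_sub_comm] at h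
  rw [H.gap_sub_gap hx (H.proxMap_mem x)]
  linarith

lemma gap_proxMap_le (H : IsComposite f ψ L) {x : EuclideanSpace ℝ (Fin n)}
    (hx : x ∈ effDom ψ) : gap f ψ (proxMap f ψ L x) ≤ gap f ψ x := by
  have h := H.wnormSq_proxMap_sub_le hx
  have := wnormSq_nonneg H.pos (proxMap f ψ L x - x)
  linarith

lemma wnormSq_proxMap_sub_le_gap (H : IsComposite f ψ L) {x : EuclideanSpace ℝ (Fin n)}
    (hx : x ∈ effDom ψ) : wnormSq L (proxMap f ψ L x - x) ≤ 2 * gap f ψ x := by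
  have h := H.wnormSq_proxMap_sub_le hx
  have := H.gap_nonneg (H.proxMap_mem x)
  linarith

/-- Stands in for Lipschitz continuity of the gradient: `f (x + t • h)` is bounded below by the
tangent at `p` and above by the quadratic model at `x`, and `f x` by the model at `p`. -/
lemma inner_gradient_sub_le (H : IsComposite f ψ L) {t : ℝ} (ht : 0 < t)
    (p x h : EuclideanSpace ℝ (Fin n)) :
    inner ℝ (gradient f p) h - inner ℝ (gradient f x) h ≤
      1 / t * (1 / 2 * wnormSq L (p - x)) + t / 2 * wnormSq L h := by
  have h1 := H.first_order p (x + t • h)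
  have h2 := H.smooth (x + t • h) x
  have h3 := H.smooth x p
  have e : x + t • h - p = (x - p) + t • h := by abel
  rw [e, inner_add_right, real_inner_smul_right] at h1
  rw [add_sub_cancel_left, wnormSq_smul, real_inner_smul_right] at h2
  rw [wnormSq_sub_comm] at h3
  refine le_of_mul_le_mul_left ?_ ht
  rw [mul_add, ← mul_assoc, mul_one_div_cancel ht.ne']
  linarith

lemma wnormSq_sub_le (H : IsComposite f ψ L) {t : ℝ} (ht : 0 < t)
    (u p x : EuclideanSpace ℝ (Fin n)) :
    wnormSq L (u - x) ≤ (1 + 1 / t) * wnormSq L (p - x) + (1 + t) * wnormSq L (u - p) := by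
  simp only [wnormSq, Finset.mul_sum, ← Finset.sum_add_distrib]
  refine Finset.sum_le_sum fun i _ => ?_
  simp only [PiLp.sub_apply]
  have h : 0 ≤ L i * (t * (u i - p i - 1 / t * (p i - x i)) ^ 2) :=
    mul_nonneg (H.pos i).le (by positivity)
  have e : (1 + 1 / t) * (L i * (p i - x i) ^ 2) + (1 + t) * (L i * (u i - p i) ^ 2) -
      L i * (u i - x i) ^ 2 = L i * (t * (u i - p i - 1 / t * (p i - x i)) ^ 2) := by
    field_simp
    ring
  linarith

/-- Under quadratic growth at `T(x)`, the gap there is controlled by the length of the step. -/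
lemma gap_proxMap_le_of_growth (H : IsComposite f ψ L) {μ : ℝ} (hμ : 0 < μ)
    (x : EuclideanSpace ℝ (Fin n))
    (hgrowth : μ / 2 * wdist L (proxMap f ψ L x) (solutionSet f ψ) ^ 2 ≤
      gap f ψ (proxMap f ψ L x)) :
    gap f ψ (proxMap f ψ L x) ≤ 8 * wnormSq L (proxMap f ψ L x - x) / μ := by
  have hpD := H.proxMap_mem x
  have h3 := (H.proxMap_three_point x).2
  set p := proxMap f ψ L x
  -- The estimates below give gap ≤ `(1 / t) * wnormSq L (p - x) + t * wnormSq L (p - s)`. With `t =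
  -- μ / 4` the distance term is at most half the gap and is absorbed, which yields the constant 2 ·
  -- 4 = 8.
  have ht : 0 < μ / 4 := by positivity
  have key : gap f ψ p - 1 / (μ / 4) * wnormSq L (p - x) ≤
      μ / 4 * wdist L p (solutionSet f ψ) ^ 2 := by
    refine le_mul_wdist_sq H.nonempty ht fun s hs => ?_
    have h1 := h3 s (H.solution_mem hs)
    have h2 := H.inner_gradient_sub_le ht p x (p - s)
    have h4 := H.first_order p s
    have h5 := H.wnormSq_sub_le ht s p x
    have e1 : s - x = (p - x) - (p - s) := by abel
    rw [H.gap_eq hs hpD]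
    rw [wnormSq_sub_comm s p] at h1 h5
    rw [← neg_sub p s, inner_neg_right] at h4
    have e2 : (inner ℝ (gradient f x) (s - x) : ℝ) =
        inner ℝ (gradient f x) (p - x) - inner ℝ (gradient f x) (p - s) := by
      rw [e1, inner_sub_right]
    rw [e2] at h1
    simp only [realObjective]
    linarith
  have e : 8 * wnormSq L (p - x) / μ = 2 * (1 / (μ / 4) * wnormSq L (p - x)) := by
    field_simp
    ring
  linarith

end IsComposite

/-! ### The sequence `theta` -/

lemma theta_pos (k : ℕ) : 0 < theta k := by
  induction k with
  | zero => simp [theta]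
  | succ k ih =>
    have : theta k ^ 2 < Real.sqrt (theta k ^ 4 + 4 * theta k ^ 2) := by
      refine Real.lt_sqrt_of_sq_lt ?_
      nlinarith [pow_pos ih 2]
    simp only [theta]
    linarith

lemma theta_succ_sq (k : ℕ) : theta (k + 1) ^ 2 = (1 - theta (k + 1)) * theta k ^ 2 := by
  have h : Real.sqrt (theta k ^ 4 + 4 * theta k ^ 2) ^ 2 = theta k ^ 4 + 4 * theta k ^ 2 :=
    Real.sq_sqrt (by positivity)
  simp only [theta]
  linear_combination h / 4

lemma theta_le_two_div (k : ℕ) : theta k ≤ 2 / (k + 2) := by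
  induction k with
  | zero => norm_num [theta]
  | succ k ih =>
    have hpos := theta_pos (k + 1)
    have hrec := theta_succ_sq k
    have hk : (0 : ℝ) ≤ k := k.cast_nonneg
    have hsq : theta k ^ 2 ≤ (2 / (k + 2)) ^ 2 := by
      have := theta_pos k
      gcongr
    -- In θ² = (1 - θ) θ_k² the left side increases and the right side decreases with θ. Exceeding
    -- `τ` would thus force τ² < (1 - τ) (2/(k+2))², which fails because (k+1)(k+3) ≤ (k+2)².
    by_contra! hlt
    push_cast at hlt
    set τ : ℝ := 2 / (k + 1 + 2) with hτ
    have hτ0 : 0 < τ := by positivity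
    have hle1 : theta (k + 1) ≤ 1 := by nlinarith [pow_pos (theta_pos k) 2, pow_pos hpos 2]
    have h1 : theta (k + 1) ^ 2 ≤ (1 - τ) * (2 / (k + 2)) ^ 2 := by
      rw [hrec]
      exact mul_le_mul (by linarith) hsq (sq_nonneg _) (by linarith)
    have h2 : (1 - τ) * (2 / (k + 2)) ^ 2 ≤ τ ^ 2 := by
      have e : τ ^ 2 - (1 - τ) * (2 / (k + 2)) ^ 2 =
          4 / ((k + 1 + 2) ^ 2 * (k + 2) ^ 2) := by
        rw [hτ]
        field_simp
        ring
      have : (0 : ℝ) ≤ 4 / ((k + 1 + 2) ^ 2 * (k + 2) ^ 2) := by positivity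
      linarith
    nlinarith

lemma theta_le_one (k : ℕ) : theta k ≤ 1 := by
  refine (theta_le_two_div k).trans ?_
  rw [div_le_one (by positivity)]
  linarith [(k.cast_nonneg : (0 : ℝ) ≤ k)]

/-! ### Convergence of the accelerated schemes -/

/-- The pair `(x_k, z_k)` of a scheme started at `x₀`. -/
noncomputable def Scheme.state (f : EuclideanSpace ℝ (Fin n) → ℝ)
    (ψ : EuclideanSpace ℝ (Fin n) → EReal) (L : Fin n → ℝ) (m : Scheme)
    (x₀ : EuclideanSpace ℝ (Fin n)) (k : ℕ) :
    EuclideanSpace ℝ (Fin n) × EuclideanSpace ℝ (Fin n) :=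
  match m with
  | .fista => fistaState f ψ L x₀ k
  | .apg => apgState f ψ L x₀ k

namespace IsComposite

variable {f : EuclideanSpace ℝ (Fin n) → ℝ} {ψ : EuclideanSpace ℝ (Fin n) → EReal} {L : Fin n → ℝ}

/-- The proximal inequality is applied at `x + θ • (u - x)`, whose differences from `x'` and `y` are
`-θ` times `z' - u` and `z - u`. -/
lemma fista_step (H : IsComposite f ψ L) {θ : ℝ} (h0 : 0 < θ) (h1 : θ ≤ 1)
    {x z y x' z' u : EuclideanSpace ℝ (Fin n)} (hx : x ∈ effDom ψ) (hu : u ∈ effDom ψ)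
    (hy : y = (1 - θ) • x + θ • z) (hx' : x' = proxMap f ψ L y)
    (hz' : z' = z + (1 / θ) • (x' - y)) :
    realObjective f ψ x' - realObjective f ψ u + θ ^ 2 / 2 * wnormSq L (z' - u) ≤
      (1 - θ) * (realObjective f ψ x - realObjective f ψ u) + θ ^ 2 / 2 * wnormSq L (z - u) := by
  have hcomb := H.lineMap_mem hx hu h0.le h1
  have key := H.realObjective_proxMap_le y hcomb
  have hconv := H.realObjective_lineMap_le hx hu h0.le h1
  rw [← hx'] at key
  have hθz' : θ • z' = x' - (1 - θ) • x := by
    rw [hz', smul_add, smul_smul, mul_one_div_cancel h0.ne', hy]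
    module
  have e1 : x + θ • (u - x) - x' = (-θ) • (z' - u) := by
    have : (-θ) • (z' - u) = θ • u - θ • z' := by module
    rw [this, hθz']
    module
  have e2 : x + θ • (u - x) - y = (-θ) • (z - u) := by
    rw [hy]
    module
  rw [e1, e2, wnormSq_smul, wnormSq_smul] at key
  linarith

/-- The point `x'` is the convex combination of `x` and `z'` with weight `θ`, hence in the domain.
The three point inequality for `z'`, multiplied by `θ`, supplies the telescoping terms. -/
lemma apg_step (H : IsComposite f ψ L) {θ : ℝ} (h0 : 0 < θ) (h1 : θ ≤ 1)
    {x z y x' z' u : EuclideanSpace ℝ (Fin n)} (hx : x ∈ effDom ψ) (hu : u ∈ effDom ψ)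
    (hy : y = (1 - θ) • x + θ • z)
    (hz' : z' = argmin fun w => (proxModel L θ (gradient f y) y z w : EReal) + ψ w)
    (hx' : x' = y + θ • (z' - z)) :
    x' ∈ effDom ψ ∧
    realObjective f ψ x' - realObjective f ψ u + θ ^ 2 / 2 * wnormSq L (z' - u) ≤
      (1 - θ) * (realObjective f ψ x - realObjective f ψ u) + θ ^ 2 / 2 * wnormSq L (z - u) := by
  obtain ⟨hzD, h3⟩ := H.argmin_three_point h0 _ y z hz'
  have hx'' : x' = x + θ • (z' - x) := by
    rw [hx', hy]
    module
  refine ⟨hx'' ▸ H.lineMap_mem hx hzD h0.le h1, ?_⟩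
  have hu3 := h3 u hu
  have hψ := H.toReal_lineMap_le hx hzD h0.le h1
  rw [← hx''] at hψ
  have hs := H.smooth x' y
  have hfx := H.first_order y x
  have hfu := H.first_order y u
  have e1 : x' - y = θ • (z' - z) := by rw [hx', add_sub_cancel_left]
  have e2 : x' - y = (1 - θ) • (x - y) + θ • (z' - y) := by
    rw [hx'']
    module
  have e3 : wnormSq L (x' - y) = θ ^ 2 * wnormSq L (z' - z) := by rw [e1, wnormSq_smul]
  rw [e3, e2, inner_add_right, real_inner_smul_right, real_inner_smul_right] at hs
  simp only [proxModel] at hu3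
  rw [wnormSq_sub_comm u z', wnormSq_sub_comm u z] at hu3
  have m1 := mul_le_mul_of_nonneg_left hu3 h0.le
  have m2 := mul_le_mul_of_nonneg_left hfx (sub_nonneg.2 h1)
  have m3 := mul_le_mul_of_nonneg_left hfu h0.le
  simp only [realObjective]
  linarith

lemma state_step (H : IsComposite f ψ L) (m : Scheme) {x₀ u : EuclideanSpace ℝ (Fin n)}
    (hu : u ∈ effDom ψ) {k : ℕ} (hx : (m.state f ψ L x₀ k).1 ∈ effDom ψ) :
    (m.state f ψ L x₀ (k + 1)).1 ∈ effDom ψ ∧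
    realObjective f ψ (m.state f ψ L x₀ (k + 1)).1 - realObjective f ψ u +
        theta k ^ 2 / 2 * wnormSq L ((m.state f ψ L x₀ (k + 1)).2 - u) ≤
      (1 - theta k) * (realObjective f ψ (m.state f ψ L x₀ k).1 - realObjective f ψ u) +
        theta k ^ 2 / 2 * wnormSq L ((m.state f ψ L x₀ k).2 - u) := by
  cases m with
  | fista =>
    exact ⟨H.proxMap_mem _,
      H.fista_step (theta_pos k) (theta_le_one k) hx hu rfl rfl rfl⟩
  | apg => exact H.apg_step (theta_pos k) (theta_le_one k) hx hu rfl rfl rfl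

lemma state_mem (H : IsComposite f ψ L) (m : Scheme) {x₀ : EuclideanSpace ℝ (Fin n)}
    (hx₀ : x₀ ∈ effDom ψ) (k : ℕ) : (m.state f ψ L x₀ k).1 ∈ effDom ψ := by
  induction k with
  | zero => cases m <;> exact hx₀
  | succ k ih => exact (H.state_step m hx₀ ih).1

/-- At the first step 1 - θ₀ = 0 removes the initial objective value. Afterwards `theta_succ_sq`
gives the previous bound, multiplied by 1 - θ_{k+1}, exactly the weight that cancels the old `z`
term; the sign of F(x_k) - F(u) is irrelevant. -/
lemma state_bound (H : IsComposite f ψ L) (m : Scheme) {x₀ u : EuclideanSpace ℝ (Fin n)}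
    (hx₀ : x₀ ∈ effDom ψ) (hu : u ∈ effDom ψ) (k : ℕ) :
    realObjective f ψ (m.state f ψ L x₀ (k + 1)).1 - realObjective f ψ u +
        theta k ^ 2 / 2 * wnormSq L ((m.state f ψ L x₀ (k + 1)).2 - u) ≤
      theta k ^ 2 / 2 * wnormSq L (x₀ - u) := by
  induction k with
  | zero =>
    have h := (H.state_step m hu (H.state_mem m hx₀ 0)).2
    have hz : (m.state f ψ L x₀ 0).2 = x₀ := by cases m <;> rfl
    rw [hz] at h
    simpa [theta] using h
  | succ k ih =>
    have h := (H.state_step m hu (H.state_mem m hx₀ (k + 1))).2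
    have hm := mul_le_mul_of_nonneg_left ih (sub_nonneg.2 (theta_le_one (k + 1)))
    have e := theta_succ_sq k
    rw [e] at h ⊢
    linarith

lemma run_mem (H : IsComposite f ψ L) (m : Scheme) {x₀ : EuclideanSpace ℝ (Fin n)}
    (hx₀ : x₀ ∈ effDom ψ) (K : ℕ) : m.run f ψ L x₀ K ∈ effDom ψ := by
  have : m.run f ψ L x₀ K = (m.state f ψ L x₀ K).1 := by cases m <;> rfl
  exact this ▸ H.state_mem m hx₀ K

lemma run_bound (H : IsComposite f ψ L) (m : Scheme) {x₀ u : EuclideanSpace ℝ (Fin n)}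
    (hx₀ : x₀ ∈ effDom ψ) (hu : u ∈ effDom ψ) {K : ℕ} (hK : 1 ≤ K) :
    realObjective f ψ (m.run f ψ L x₀ K) - realObjective f ψ u ≤
      theta (K - 1) ^ 2 / 2 * wnormSq L (x₀ - u) := by
  obtain ⟨k, rfl⟩ := Nat.exists_eq_add_of_le' hK
  have e : m.run f ψ L x₀ (k + 1) = (m.state f ψ L x₀ (k + 1)).1 := by cases m <;> rfl
  have h := H.state_bound m hx₀ hu k
  have hn := wnormSq_nonneg H.pos ((m.state f ψ L x₀ (k + 1)).2 - u)
  rw [e, Nat.add_sub_cancel]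
  nlinarith [sq_nonneg (theta k)]

lemma gap_run_le (H : IsComposite f ψ L) (m : Scheme) {x₀ : EuclideanSpace ℝ (Fin n)}
    (hx₀ : x₀ ∈ effDom ψ) {K : ℕ} (hK : 1 ≤ K) : gap f ψ (m.run f ψ L x₀ K) ≤ gap f ψ x₀ := by
  have h := H.run_bound m hx₀ hx₀ hK
  rw [sub_self, wnormSq_zero, mul_zero, ← H.gap_sub_gap (H.run_mem m hx₀ K) hx₀] at h
  linarith

lemma gap_run_le_of_growth (H : IsComposite f ψ L) (m : Scheme) {x₀ : EuclideanSpace ℝ (Fin n)}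
    (hx₀ : x₀ ∈ effDom ψ) {K : ℕ} (hK : 1 ≤ K) {μ : ℝ} (hμ : 0 < μ)
    (hgrowth : μ / 2 * wdist L x₀ (solutionSet f ψ) ^ 2 ≤ gap f ψ x₀) :
    gap f ψ (m.run f ψ L x₀ K) ≤ theta (K - 1) ^ 2 / μ * gap f ψ x₀ := by
  have hθ : 0 < theta (K - 1) ^ 2 := pow_pos (theta_pos _) 2
  have h : gap f ψ (m.run f ψ L x₀ K) ≤
      theta (K - 1) ^ 2 / 2 * wdist L x₀ (solutionSet f ψ) ^ 2 := by
    refine le_mul_wdist_sq H.nonempty (half_pos hθ) fun s hs => ?_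
    rw [H.gap_eq hs (H.run_mem m hx₀ K)]
    exact H.run_bound m hx₀ (H.solution_mem hs) hK
  refine h.trans ?_
  have := mul_le_mul_of_nonneg_left hgrowth (div_pos hθ hμ).le
  refine le_trans (le_of_eq ?_) this
  field_simp

lemma growth_real (H : IsComposite f ψ L) {x₀ x : EuclideanSpace ℝ (Fin n)} {μ ν : ℝ}
    (hgrowth : QuadraticErrorBound f ψ L x₀ μ) (hx₀ : x₀ ∈ effDom ψ) (hx : x ∈ effDom ψ)
    (hle : gap f ψ x ≤ gap f ψ x₀) (hν : ν ≤ μ) :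
    ν / 2 * wdist L x (solutionSet f ψ) ^ 2 ≤ gap f ψ x := by
  obtain ⟨s, hs⟩ := H.nonempty
  have hsub := H.gap_sub_gap hx hx₀
  have h := hgrowth x (by
    rw [H.objective_eq hx, H.objective_eq hx₀, EReal.coe_le_coe_iff]
    linarith)
  rw [H.optValue_eq hs, H.objective_eq hx, ← EReal.coe_add, EReal.coe_le_coe_iff] at h
  rw [H.gap_eq hs hx]
  nlinarith [sq_nonneg (wdist L x (solutionSet f ψ))]

end IsComposite

/-! ### Estimates and restart periods -/

lemma estimate_eq (μ₀ : ℝ) (s : ℕ) : estimate μ₀ s = μ₀ / 2 ^ s := by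
  induction s with
  | zero => simp [estimate]
  | succ s ih => rw [estimate, ih, pow_succ, div_div]

lemma estimate_pos {μ₀ : ℝ} (h : 0 < μ₀) (s : ℕ) : 0 < estimate μ₀ s := by
  rw [estimate_eq]
  positivity

lemma estimate_antitone {μ₀ : ℝ} (h : 0 < μ₀) : Antitone (estimate μ₀) :=
  antitone_nat_of_succ_le fun s => half_le_self (estimate_pos h s).le

lemma restartPeriod_anti {μ ν : ℝ} (hμ : 0 < μ) (h : μ ≤ ν) :
    restartPeriod ν ≤ restartPeriod μ := by
  unfold restartPeriod
  gcongr

lemma two_mul_sqrt_le_restartPeriod_add_one (μ : ℝ) :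
    2 * Real.sqrt (Real.exp 1 / μ) ≤ restartPeriod μ + 1 := by
  have := Nat.le_ceil (2 * Real.sqrt (Real.exp 1 / μ) - 1)
  rw [restartPeriod]
  linarith

lemma restartPeriod_le (μ : ℝ) : (restartPeriod μ : ℝ) ≤ 2 * Real.sqrt (Real.exp 1 / μ) := by
  rcases le_total 0 (2 * Real.sqrt (Real.exp 1 / μ) - 1) with h | h
  · have := Nat.ceil_lt_add_one h
    rw [restartPeriod]
    linarith
  · rw [restartPeriod, Nat.ceil_eq_zero.2 h]
    simp

/-- This dictates the period: θ_{K-1} ≤ 2/(K+1) and K + 1 ≥ 2√(e/μ). -/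
lemma theta_sq_div_le {μ : ℝ} (hμ : 0 < μ) (hK : 1 ≤ restartPeriod μ) :
    theta (restartPeriod μ - 1) ^ 2 / μ ≤ Real.exp (-1) := by
  have hle := two_mul_sqrt_le_restartPeriod_add_one μ
  obtain ⟨k, hk⟩ := Nat.exists_eq_add_of_le' hK
  rw [hk] at hle ⊢
  rw [Nat.add_sub_cancel]
  push_cast at hle
  have hpos : 0 < Real.sqrt (Real.exp 1 / μ) := Real.sqrt_pos.2 (by positivity)
  have hθ : theta k ≤ 1 / Real.sqrt (Real.exp 1 / μ) := by
    refine (theta_le_two_div k).trans ?_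
    rw [div_le_div_iff₀ (by positivity) hpos]
    linarith
  have hsq : theta k ^ 2 ≤ (1 / Real.sqrt (Real.exp 1 / μ)) ^ 2 := by
    have := theta_pos k
    gcongr
  rw [div_pow, one_pow, Real.sq_sqrt (by positivity), one_div_div] at hsq
  rw [div_le_iff₀ hμ, Real.exp_neg]
  exact hsq.trans (le_of_eq (by ring))

lemma theta_sq_div_pow_le {μ : ℝ} (hμ : 0 < μ) (hK : 1 ≤ restartPeriod μ) (t : ℕ) :
    (theta (restartPeriod μ - 1) ^ 2 / μ) ^ t ≤ Real.exp (-t) := by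
  have h := pow_le_pow_left₀ (by positivity) (theta_sq_div_le hμ hK) t
  rwa [← Real.exp_nat_mul, mul_neg_one] at h

lemma mul_exp_neg_le {a ε : ℝ} (ha : 0 ≤ a) (hε : 0 < ε) {t : ℝ} (h : Real.log (a / ε) ≤ t) :
    a * Real.exp (-t) ≤ ε := by
  -- For `a = 0` the logarithm takes its default value 0, and the product vanishes anyway.
  rcases ha.eq_or_lt with rfl | ha
  · simpa using hε.le
  rw [Real.log_le_iff_le_exp (by positivity), div_le_iff₀ hε] at h
  rw [Real.exp_neg, ← div_eq_mul_inv, div_le_iff₀ (Real.exp_pos t)]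
  linarith

/-! ### A single restart pass -/

variable {f : EuclideanSpace ℝ (Fin n) → ℝ} {ψ : EuclideanSpace ℝ (Fin n) → EReal}
  {L : Fin n → ℝ}

/-- `X` restarts accelerated schemes, with the period given by `μ`, from `T(p)` for `t` rounds. -/
structure IsRestartPass (f : EuclideanSpace ℝ (Fin n) → ℝ) (ψ : EuclideanSpace ℝ (Fin n) → EReal)
    (L : Fin n → ℝ) (μ : ℝ) (p : EuclideanSpace ℝ (Fin n)) (m : ℕ → Scheme)
    (X : ℕ → EuclideanSpace ℝ (Fin n)) (t : ℕ) : Prop where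
  start : X 0 = proxMap f ψ L p
  call : ∀ τ < t, X (τ + 1) = (m τ).run f ψ L (X τ) (restartPeriod μ)

/-- The squared length of the proximal gradient step at `x`. -/
noncomputable def residual (f : EuclideanSpace ℝ (Fin n) → ℝ)
    (ψ : EuclideanSpace ℝ (Fin n) → EReal) (L : Fin n → ℝ) (x : EuclideanSpace ℝ (Fin n)) : ℝ :=
  wnormSq L (proxMap f ψ L x - x)

/-- The residual allowed after `t` rounds of a pass started at `p` with the estimate `μ`. -/
noncomputable def threshold (f : EuclideanSpace ℝ (Fin n) → ℝ)
    (ψ : EuclideanSpace ℝ (Fin n) → EReal) (L : Fin n → ℝ) (μ : ℝ)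
    (p : EuclideanSpace ℝ (Fin n)) (t : ℕ) : ℝ :=
  16 * residual f ψ L p / μ * (theta (restartPeriod μ - 1) ^ 2 / μ) ^ t

/-- Descent alone bounds the residual at `p` by twice the gap, whence 32 = 16 · 2; no error bound
enters. -/
lemma IsComposite.threshold_le (H : IsComposite f ψ L) {μ ν ε : ℝ} (hν : 0 < ν) (hνμ : ν ≤ μ)
    (hK : 1 ≤ restartPeriod μ) (hε : 0 < ε) {p x₀ : EuclideanSpace ℝ (Fin n)}
    (hp : p ∈ effDom ψ) (hle : gap f ψ p ≤ gap f ψ x₀) {t : ℕ}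
    (ht : Real.log (32 * gap f ψ x₀ / (ε * ν)) ≤ t) : threshold f ψ L μ p t ≤ ε := by
  have hμ := hν.trans_le hνμ
  have hg := (H.gap_nonneg hp).trans hle
  have h1 : 16 * residual f ψ L p / μ ≤ 32 * gap f ψ x₀ / ν := by
    have := H.wnormSq_proxMap_sub_le_gap hp
    refine div_le_div₀ (by positivity) ?_ hν hνμ
    rw [residual]
    linarith
  have h2 : Real.log (32 * gap f ψ x₀ / ν / ε) ≤ t := by rwa [div_div, mul_comm ν ε]
  refine le_trans ?_ (mul_exp_neg_le (by positivity) hε h2)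
  exact mul_le_mul h1 (theta_sq_div_pow_le hμ hK t) (by positivity) (by positivity)

namespace IsRestartPass

variable {μ : ℝ} {p x₀ : EuclideanSpace ℝ (Fin n)} {m : ℕ → Scheme}
  {X : ℕ → EuclideanSpace ℝ (Fin n)} {t : ℕ}

lemma mem_and_gap_le (P : IsRestartPass f ψ L μ p m X t) (H : IsComposite f ψ L)
    (hp : p ∈ effDom ψ) (hK : 1 ≤ restartPeriod μ) {τ : ℕ} (hτ : τ ≤ t) :
    X τ ∈ effDom ψ ∧ gap f ψ (X τ) ≤ gap f ψ p := by
  induction τ with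
  | zero => exact P.start ▸ ⟨H.proxMap_mem p, H.gap_proxMap_le hp⟩
  | succ τ ih =>
    obtain ⟨hX, hg⟩ := ih (by omega)
    rw [P.call τ (by omega)]
    exact ⟨H.run_mem _ hX _, (H.gap_run_le _ hX hK).trans hg⟩

/-- The reference value is the gap at `T(p)` rather than at `p`, since that is what the residual at
`p` controls. -/
lemma gap_le_of_growth (P : IsRestartPass f ψ L μ p m X t) (H : IsComposite f ψ L)
    (hp : p ∈ effDom ψ) (hK : 1 ≤ restartPeriod μ) (hμ : 0 < μ) {μF : ℝ} (hμF : μ ≤ μF)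
    (hx₀ : x₀ ∈ effDom ψ) (hgrowth : QuadraticErrorBound f ψ L x₀ μF)
    (hle : gap f ψ p ≤ gap f ψ x₀) {τ : ℕ} (hτ : τ ≤ t) :
    gap f ψ (X τ) ≤ (theta (restartPeriod μ - 1) ^ 2 / μ) ^ τ * gap f ψ (proxMap f ψ L p) := by
  induction τ with
  | zero => rw [P.start, pow_zero, one_mul]
  | succ τ ih =>
    obtain ⟨hX, hg⟩ := P.mem_and_gap_le H hp hK (show τ ≤ t by omega)
    rw [P.call τ (by omega), pow_succ', mul_assoc]
    refine (H.gap_run_le_of_growth _ hX hK hμ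
      (H.growth_real hgrowth hx₀ hX (hg.trans hle) hμF)).trans ?_
    exact mul_le_mul_of_nonneg_left (ih (by omega)) (by positivity)

/-- Explains the constant in `C_s`: 16 = 2 · 8, from descent at `X τ` and the converse estimate at
`p`. -/
lemma residual_le_threshold (P : IsRestartPass f ψ L μ p m X t) (H : IsComposite f ψ L)
    (hp : p ∈ effDom ψ) (hK : 1 ≤ restartPeriod μ) (hμ : 0 < μ) {μF : ℝ} (hμF : μ ≤ μF)
    (hx₀ : x₀ ∈ effDom ψ) (hgrowth : QuadraticErrorBound f ψ L x₀ μF)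
    (hle : gap f ψ p ≤ gap f ψ x₀) {τ : ℕ} (hτ : τ ≤ t) :
    residual f ψ L (X τ) ≤ threshold f ψ L μ p τ := by
  have h1 := H.wnormSq_proxMap_sub_le_gap (P.mem_and_gap_le H hp hK hτ).1
  have h2 := P.gap_le_of_growth H hp hK hμ hμF hx₀ hgrowth hle hτ
  have h3 := H.gap_proxMap_le_of_growth hμ p
    (H.growth_real hgrowth hx₀ (H.proxMap_mem p) ((H.gap_proxMap_le hp).trans hle) hμF)
  have h4 := mul_le_mul_of_nonneg_left h3
    (show 0 ≤ (theta (restartPeriod μ - 1) ^ 2 / μ) ^ τ by positivity)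
  simp only [residual, threshold]
  have e : 16 * wnormSq L (proxMap f ψ L p - p) / μ =
    2 * (8 * wnormSq L (proxMap f ψ L p - p) / μ) := by ring
  rw [e]
  linarith

lemma residual_le_of_growth (P : IsRestartPass f ψ L μ p m X t) (H : IsComposite f ψ L)
    (hp : p ∈ effDom ψ) (hK : 1 ≤ restartPeriod μ) (hμ : 0 < μ) {μF ε : ℝ} (hμF : μ ≤ μF)
    (hε : 0 < ε) (hx₀ : x₀ ∈ effDom ψ) (hgrowth : QuadraticErrorBound f ψ L x₀ μF)
    (hle : gap f ψ p ≤ gap f ψ x₀) {τ : ℕ} (hτ : τ ≤ t)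
    (hlog : Real.log (2 * gap f ψ x₀ / ε) ≤ τ) : residual f ψ L (X τ) ≤ ε := by
  have h1 := H.wnormSq_proxMap_sub_le_gap (P.mem_and_gap_le H hp hK hτ).1
  have h2 := P.gap_le_of_growth H hp hK hμ hμF hx₀ hgrowth hle hτ
  have h0 := H.gap_nonneg (H.proxMap_mem p)
  have h4 := mul_le_mul (theta_sq_div_pow_le hμ hK τ) ((H.gap_proxMap_le hp).trans hle) h0
    (Real.exp_pos _).le
  have h5 := mul_exp_neg_le (a := 2 * gap f ψ x₀)
    (by linarith [H.gap_nonneg hx₀]) hε hlog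
  rw [residual]
  linarith

end IsRestartPass

/-- The exit test of the inner loop. -/
def InnerExit (f : EuclideanSpace ℝ (Fin n) → ℝ) (ψ : EuclideanSpace ℝ (Fin n) → EReal)
    (L : Fin n → ℝ) (ε μ : ℝ) (p x : EuclideanSpace ℝ (Fin n)) (t : ℕ) : Prop :=
  threshold f ψ L μ p t < residual f ψ L x ∨ residual f ψ L x ≤ ε

lemma innerExit_of_threshold_le {ε μ : ℝ} {p x : EuclideanSpace ℝ (Fin n)} {t : ℕ}
    (h : threshold f ψ L μ p t ≤ ε) : InnerExit f ψ L ε μ p x t :=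
  (lt_or_ge _ _).imp_right fun hle => le_trans hle h

/-! ### Termination -/

section Existence

/-- The iterates of the pass started from `p` with the estimate `μ`. -/
noncomputable def passIterate (f : EuclideanSpace ℝ (Fin n) → ℝ)
    (ψ : EuclideanSpace ℝ (Fin n) → EReal) (L : Fin n → ℝ) (m : ℕ → Scheme) (μ : ℝ)
    (p : EuclideanSpace ℝ (Fin n)) : ℕ → EuclideanSpace ℝ (Fin n)
  | 0 => proxMap f ψ L p
  | τ + 1 => (m τ).run f ψ L (passIterate f ψ L m μ p τ) (restartPeriod μ)

lemma isRestartPass_passIterate (m : ℕ → Scheme) (μ : ℝ) (p : EuclideanSpace ℝ (Fin n)) (t : ℕ) :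
    IsRestartPass f ψ L μ p m (passIterate f ψ L m μ p) t :=
  ⟨rfl, fun _ _ => rfl⟩

/-- The number of rounds of the pass started from `p`. -/
noncomputable def passLength (f : EuclideanSpace ℝ (Fin n) → ℝ)
    (ψ : EuclideanSpace ℝ (Fin n) → EReal) (L : Fin n → ℝ) (m : ℕ → Scheme) (ε μ : ℝ)
    (p : EuclideanSpace ℝ (Fin n)) : ℕ :=
  sInf {t | 1 ≤ t ∧ InnerExit f ψ L ε μ p (passIterate f ψ L m μ p t) t}

/-- The starting points of the passes. -/
noncomputable def passStart (f : EuclideanSpace ℝ (Fin n) → ℝ)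
    (ψ : EuclideanSpace ℝ (Fin n) → EReal) (L : Fin n → ℝ) (m : ℕ → ℕ → Scheme) (ε μ₀ : ℝ)
    (x₀ : EuclideanSpace ℝ (Fin n)) : ℕ → EuclideanSpace ℝ (Fin n)
  | 0 => x₀
  | s + 1 =>
    passIterate f ψ L (m s) (estimate μ₀ s) (passStart f ψ L m ε μ₀ x₀ s)
      (passLength f ψ L (m s) ε (estimate μ₀ s) (passStart f ψ L m ε μ₀ x₀ s))

lemma IsComposite.passLength_mem (H : IsComposite f ψ L) {ε μ : ℝ} (hε : 0 < ε) (hμ : 0 < μ)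
    (hK : 1 ≤ restartPeriod μ) (m : ℕ → Scheme) {p : EuclideanSpace ℝ (Fin n)}
    (hp : p ∈ effDom ψ) :
    passLength f ψ L m ε μ p ∈
      {t | 1 ≤ t ∧ InnerExit f ψ L ε μ p (passIterate f ψ L m μ p t) t} := by
  -- The threshold is compared with the pass's own estimate, so the inner loop stops even when `μ`
  -- is too large for the error bound.
  refine Nat.sInf_mem ⟨max 1 ⌈Real.log (32 * gap f ψ p / (ε * μ))⌉₊, le_max_left _ _, ?_⟩
  refine innerExit_of_threshold_le (H.threshold_le hμ le_rfl hK hε hp le_rfl ?_)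
  exact (Nat.le_ceil _).trans (Nat.cast_le.2 (le_max_right _ _))

lemma IsComposite.passStart_mem (H : IsComposite f ψ L) {ε μ₀ : ℝ} (hμ₀ : 0 < μ₀)
    (hK : 1 ≤ restartPeriod μ₀) (m : ℕ → ℕ → Scheme) {x₀ : EuclideanSpace ℝ (Fin n)}
    (hx₀ : x₀ ∈ effDom ψ) (s : ℕ) :
    passStart f ψ L m ε μ₀ x₀ s ∈ effDom ψ ∧
      gap f ψ (passStart f ψ L m ε μ₀ x₀ s) ≤ gap f ψ x₀ := by
  induction s with
  | zero => exact ⟨hx₀, le_rfl⟩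
  | succ s ih =>
    have hKs := hK.trans (restartPeriod_anti (estimate_pos hμ₀ s)
      (estimate_antitone hμ₀ s.zero_le))
    have h := (isRestartPass_passIterate (f := f) (ψ := ψ) (L := L) (m s) (estimate μ₀ s)
      (passStart f ψ L m ε μ₀ x₀ s)
      (passLength f ψ L (m s) ε (estimate μ₀ s) (passStart f ψ L m ε μ₀ x₀ s))).mem_and_gap_le
        H ih.1 hKs le_rfl
    exact ⟨h.1, h.2.trans ih.2⟩

lemma IsComposite.residual_passStart_succ_le (H : IsComposite f ψ L) {ε μ₀ μF : ℝ}
    (hμ₀ : 0 < μ₀) (hε : 0 < ε) (hK : 1 ≤ restartPeriod μ₀) (m : ℕ → ℕ → Scheme)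
    {x₀ : EuclideanSpace ℝ (Fin n)} (hx₀ : x₀ ∈ effDom ψ)
    (hgrowth : QuadraticErrorBound f ψ L x₀ μF) {s : ℕ} (hs : estimate μ₀ s ≤ μF) :
    residual f ψ L (passStart f ψ L m ε μ₀ x₀ (s + 1)) ≤ ε := by
  obtain ⟨hp, hle⟩ := H.passStart_mem (ε := ε) hμ₀ hK m hx₀ s
  have hμs := estimate_pos hμ₀ s
  have hKs := hK.trans (restartPeriod_anti hμs (estimate_antitone hμ₀ s.zero_le))
  refine (H.passLength_mem hε hμs hKs (m s) hp).2.resolve_left (not_lt.2 ?_)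
  exact (isRestartPass_passIterate (m s) _ _ _).residual_le_threshold H hp hKs hμs hs hx₀ hgrowth
    hle le_rfl

lemma exists_estimate_le {μ₀ μF : ℝ} (hμF : 0 < μF) : ∃ s, estimate μ₀ s ≤ μF := by
  obtain ⟨s, hs⟩ := pow_unbounded_of_one_lt (μ₀ / μF) (one_lt_two (α := ℝ))
  refine ⟨s, ?_⟩
  rw [estimate_eq, div_le_iff₀ (by positivity)]
  rw [div_lt_iff₀ hμF] at hs
  linarith

open Classical in
lemma IsComposite.nonempty_execution (H : IsComposite f ψ L) {ε μ₀ μF : ℝ}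
    (hμ₀ : 0 < μ₀) (hμF : 0 < μF) (hε : 0 < ε) (hK : 1 ≤ restartPeriod μ₀)
    (m : ℕ → ℕ → Scheme) {x₀ : EuclideanSpace ℝ (Fin n)} (hx₀ : x₀ ∈ effDom ψ)
    (hgrowth : QuadraticErrorBound f ψ L x₀ μF) : Nonempty (Execution f ψ L m ε μ₀ x₀) := by
  -- The passes are defined for all `s`, also past termination; the point with index `s + 1` is the
  -- output of pass `s`, and `sHat` is the first `s` that meets the test.
  have hex : ∃ s, residual f ψ L (passStart f ψ L m ε μ₀ x₀ (s + 1)) ≤ ε :=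
    (exists_estimate_le hμF).imp fun s hs =>
      H.residual_passStart_succ_le hμ₀ hε hK m hx₀ hgrowth hs
  have hmem := fun s => H.passLength_mem hε (estimate_pos hμ₀ s)
    (hK.trans (restartPeriod_anti (estimate_pos hμ₀ s) (estimate_antitone hμ₀ s.zero_le))) (m s)
    (H.passStart_mem (ε := ε) hμ₀ hK m hx₀ s).1
  exact ⟨{
    sHat := Nat.find hex
    t := fun s => passLength f ψ L (m s) ε (estimate μ₀ s) (passStart f ψ L m ε μ₀ x₀ s)
    x := fun s => passIterate f ψ L (m s) (estimate μ₀ s) (passStart f ψ L m ε μ₀ x₀ s)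
    prev := passStart f ψ L m ε μ₀ x₀
    prev_zero := rfl
    prev_succ := fun _ _ => rfl
    start := fun _ _ => rfl
    call := fun _ _ _ _ => rfl
    inner_pos := fun s _ => (hmem s).1
    inner_exit := fun s _ => (hmem s).2
    inner_continue := fun s _ τ h1 hlt hexit => Nat.notMem_of_lt_sInf hlt ⟨h1, hexit⟩
    outer_exit := Nat.find_spec hex
    outer_continue := fun s hs => Nat.find_min hex hs }⟩

end Existence

/-! ### Number and length of the passes -/

namespace Execution

variable {m : ℕ → ℕ → Scheme} {ε μ₀ μF : ℝ} {x₀ : EuclideanSpace ℝ (Fin n)}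

lemma isRestartPass (R : Execution f ψ L m ε μ₀ x₀) {s : ℕ} (hs : s ≤ R.sHat) :
    IsRestartPass f ψ L (estimate μ₀ s) (R.prev s) (m s) (R.x s) (R.t s) :=
  ⟨R.start s hs, R.call s hs⟩

lemma innerExit (R : Execution f ψ L m ε μ₀ x₀) {s : ℕ} (hs : s ≤ R.sHat) :
    InnerExit f ψ L ε (estimate μ₀ s) (R.prev s) (R.x s (R.t s)) (R.t s) := by
  have h := R.inner_exit s hs
  rwa [R.start s hs] at h

lemma le_of_innerExit (R : Execution f ψ L m ε μ₀ x₀) {s : ℕ} (hs : s ≤ R.sHat) {τ : ℕ}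
    (hτ : 1 ≤ τ)
    (h : τ ≤ R.t s → InnerExit f ψ L ε (estimate μ₀ s) (R.prev s) (R.x s τ) τ) :
    R.t s ≤ τ := by
  by_contra! hlt
  have hc := R.inner_continue s hs τ hτ hlt
  rw [R.start s hs] at hc
  exact hc (h hlt.le)

lemma prev_mem (R : Execution f ψ L m ε μ₀ x₀) (H : IsComposite f ψ L) (hμ₀ : 0 < μ₀)
    (hK : 1 ≤ restartPeriod μ₀) (hx₀ : x₀ ∈ effDom ψ) {s : ℕ} (hs : s ≤ R.sHat) :
    R.prev s ∈ effDom ψ ∧ gap f ψ (R.prev s) ≤ gap f ψ x₀ := by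
  induction s with
  | zero => exact R.prev_zero.symm ▸ ⟨hx₀, le_rfl⟩
  | succ s ih =>
    obtain ⟨hp, hle⟩ := ih (by omega)
    have hKs := hK.trans (restartPeriod_anti (estimate_pos hμ₀ s)
      (estimate_antitone hμ₀ s.zero_le))
    obtain ⟨h1, h2⟩ := (R.isRestartPass (show s ≤ R.sHat by omega)).mem_and_gap_le H hp hKs le_rfl
    rw [R.prev_succ s (by omega)]
    exact ⟨h1, h2.trans hle⟩

lemma sHat_le (R : Execution f ψ L m ε μ₀ x₀) (H : IsComposite f ψ L) (hμ₀ : 0 < μ₀)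
    (hK : 1 ≤ restartPeriod μ₀) (hx₀ : x₀ ∈ effDom ψ)
    (hgrowth : QuadraticErrorBound f ψ L x₀ μF) {s : ℕ} (hs : estimate μ₀ s ≤ μF) :
    R.sHat ≤ s := by
  by_contra! hlt
  obtain ⟨hp, hle⟩ := R.prev_mem H hμ₀ hK hx₀ hlt.le
  have hμs := estimate_pos hμ₀ s
  have hKs := hK.trans (restartPeriod_anti hμs (estimate_antitone hμ₀ s.zero_le))
  refine R.outer_continue s hlt ((R.innerExit hlt.le).resolve_left (not_lt.2 ?_))
  exact (R.isRestartPass hlt.le).residual_le_threshold H hp hKs hμs hs hx₀ hgrowth hle le_rfl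

lemma t_le_of_growth (R : Execution f ψ L m ε μ₀ x₀) (H : IsComposite f ψ L) (hμ₀ : 0 < μ₀)
    (hε : 0 < ε) (hK : 1 ≤ restartPeriod μ₀) (hx₀ : x₀ ∈ effDom ψ)
    (hgrowth : QuadraticErrorBound f ψ L x₀ μF) {s : ℕ} (hsR : s ≤ R.sHat)
    (hs : estimate μ₀ s ≤ μF) : R.t s ≤ max 1 ⌈Real.log (2 * gap f ψ x₀ / ε)⌉₊ := by
  obtain ⟨hp, hle⟩ := R.prev_mem H hμ₀ hK hx₀ hsR
  have hμs := estimate_pos hμ₀ s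
  have hKs := hK.trans (restartPeriod_anti hμs (estimate_antitone hμ₀ s.zero_le))
  refine R.le_of_innerExit hsR (le_max_left _ _) fun hτ => Or.inr ?_
  refine (R.isRestartPass hsR).residual_le_of_growth H hp hKs hμs hs hε hx₀ hgrowth hle hτ ?_
  exact (Nat.le_ceil _).trans (Nat.cast_le.2 (le_max_right _ _))

lemma t_le (R : Execution f ψ L m ε μ₀ x₀) (H : IsComposite f ψ L) (hμ₀ : 0 < μ₀) (hμF : 0 < μF)
    (hε : 0 < ε) (hK : 1 ≤ restartPeriod μ₀) (hx₀ : x₀ ∈ effDom ψ) {s : ℕ} (hsR : s ≤ R.sHat)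
    (hs : μF ≤ estimate μ₀ s) : R.t s ≤ max 1 ⌈Real.log (32 * gap f ψ x₀ / (ε * μF))⌉₊ := by
  obtain ⟨hp, hle⟩ := R.prev_mem H hμ₀ hK hx₀ hsR
  have hKs := hK.trans (restartPeriod_anti (estimate_pos hμ₀ s)
    (estimate_antitone hμ₀ s.zero_le))
  refine R.le_of_innerExit hsR (le_max_left _ _) fun _ => innerExit_of_threshold_le ?_
  refine H.threshold_le hμF hs hKs hε hp hle ?_
  exact (Nat.le_ceil _).trans (Nat.cast_le.2 (le_max_right _ _))

end Execution

/-! ### Arithmetic of the bounds -/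

/-- The two ceilings differ only for negative arguments, where the maximum is 1 on both sides. For
zero gap, `Real.log 0 = 0` also gives 1. -/
lemma cast_max_one_natCeil (x : ℝ) : ((max 1 ⌈x⌉₊ : ℕ) : ℝ) = max (1 : ℝ) (⌈x⌉ : ℝ) := by
  rcases le_total 0 x with h | h
  · rw [Nat.cast_max, Nat.cast_one, natCast_ceil_eq_intCast_ceil h]
  · have h1 : ((⌈x⌉ : ℤ) : ℝ) ≤ 0 := by exact_mod_cast Int.ceil_le.2 (by simpa using h)
    rw [Nat.ceil_eq_zero.2 h, max_eq_left zero_le_one,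
      max_eq_left (by linarith), Nat.cast_one]

lemma intCast_ceil_eq_restartPeriod {μ : ℝ} (hK : 1 ≤ restartPeriod μ) :
    (⌈2 * Real.sqrt (Real.exp 1 / μ) - 1⌉ : ℝ) = restartPeriod μ := by
  have h : 0 < 2 * Real.sqrt (Real.exp 1 / μ) - 1 := Nat.ceil_pos.1 hK
  rw [restartPeriod, natCast_ceil_eq_intCast_ceil h.le]

lemma sqrt_two_pow (s : ℕ) : Real.sqrt (2 ^ s) = Real.sqrt 2 ^ s := by
  induction s with
  | zero => simp
  | succ s ih => rw [pow_succ, Real.sqrt_mul (by positivity), ih, pow_succ]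

lemma restartPeriod_estimate_le {μ₀ : ℝ} (s : ℕ) :
    (restartPeriod (estimate μ₀ s) : ℝ) ≤
      2 * Real.sqrt (Real.exp 1) * Real.sqrt (1 / μ₀) * Real.sqrt 2 ^ s := by
  refine (restartPeriod_le _).trans (le_of_eq ?_)
  have e : Real.exp 1 / estimate μ₀ s = Real.exp 1 * 2 ^ s * (1 / μ₀) := by
    rw [estimate_eq]
    field_simp
  rw [e, Real.sqrt_mul (by positivity), Real.sqrt_mul (by positivity), sqrt_two_pow]
  ring

lemma sum_restartPeriod_le {μ₀ μF : ℝ} (hμ₀ : 0 < μ₀) (hμF : 0 < μF) {j : ℕ}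
    (hj : (2 : ℝ) ^ j ≤ 2 * (μ₀ / μF)) :
    ∑ s ∈ Finset.range j, (restartPeriod (estimate μ₀ s) : ℝ) ≤
      2 * Real.sqrt (Real.exp 1) / (Real.sqrt 2 - 1) *
        (Real.sqrt (2 / μF) - Real.sqrt (1 / μ₀)) := by
  have h2 : 1 < Real.sqrt 2 := by
    rw [Real.lt_sqrt zero_le_one]
    norm_num
  refine (Finset.sum_le_sum fun s _ => restartPeriod_estimate_le s).trans ?_
  rw [← Finset.mul_sum, geom_sum_eq h2.ne']
  have hle : Real.sqrt (1 / μ₀) * Real.sqrt 2 ^ j ≤ Real.sqrt (2 / μF) := by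
    rw [← sqrt_two_pow, ← Real.sqrt_mul (by positivity)]
    refine Real.sqrt_le_sqrt ?_
    calc 1 / μ₀ * 2 ^ j ≤ 1 / μ₀ * (2 * (μ₀ / μF)) := by gcongr
      _ = 2 / μF := by field_simp
  have e : 2 * Real.sqrt (Real.exp 1) * Real.sqrt (1 / μ₀) * ((Real.sqrt 2 ^ j - 1) /
      (Real.sqrt 2 - 1)) = 2 * Real.sqrt (Real.exp 1) / (Real.sqrt 2 - 1) *
        (Real.sqrt (1 / μ₀) * Real.sqrt 2 ^ j - Real.sqrt (1 / μ₀)) := by ring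
  rw [e]
  have := sub_pos.2 h2
  gcongr

/-- The added 1 cancels the `- 1` inside the ceiling that defines the period. -/
lemma restartPeriod_add_one_le {μ μF : ℝ} (hμF : 0 < μF) (hμ : 0 < μ)
    (hK : 1 ≤ restartPeriod μ) (h : μF ≤ 2 * μ) :
    (restartPeriod μ : ℝ) + 1 ≤ (⌈2 * Real.sqrt (2 * Real.exp 1) / Real.sqrt μF⌉ : ℝ) := by
  rw [← intCast_ceil_eq_restartPeriod hK, Int.ceil_sub_one]
  push_cast
  rw [sub_add_cancel, Int.cast_le]
  refine Int.ceil_mono ?_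
  rw [mul_div_assoc, ← Real.sqrt_div (by positivity)]
  gcongr 2 * Real.sqrt ?_
  rw [div_le_div_iff₀ hμ hμF]
  nlinarith [Real.exp_pos 1]

lemma two_pow_natCeil_logb {r : ℝ} (hr : 1 < r) :
    r ≤ 2 ^ ⌈Real.logb 2 r⌉₊ ∧ (2 : ℝ) ^ ⌈Real.logb 2 r⌉₊ ≤ 2 * r := by
  have hr0 := zero_lt_one.trans hr
  have hlog : 0 < Real.logb 2 r := Real.logb_pos one_lt_two hr
  constructor
  · have h := Nat.le_ceil (Real.logb 2 r)
    rwa [Real.logb_le_iff_le_rpow one_lt_two hr0, Real.rpow_natCast] at h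
  · have h := (Nat.ceil_lt_add_one hlog.le).le
    have e : Real.logb 2 r + 1 = Real.logb 2 (2 * r) := by
      rw [Real.logb_mul two_ne_zero hr0.ne', Real.logb_self_eq_one one_lt_two, add_comm]
    rwa [e, Real.le_logb_iff_rpow_le one_lt_two (by positivity), Real.rpow_natCast] at h

/-! ### Counting the proximal steps -/

namespace Execution

variable {m : ℕ → ℕ → Scheme} {ε μ₀ μF : ℝ} {x₀ : EuclideanSpace ℝ (Fin n)}

lemma numSteps_le_of_le (R : Execution f ψ L m ε μ₀ x₀) (H : IsComposite f ψ L) (hμ₀ : 0 < μ₀)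
    (hε : 0 < ε) (hK : 1 ≤ restartPeriod μ₀) (hx₀ : x₀ ∈ effDom ψ)
    (hgrowth : QuadraticErrorBound f ψ L x₀ μF) (hle : μ₀ ≤ μF) :
    R.numSteps ≤ restartPeriod μ₀ * max 1 ⌈Real.log (2 * gap f ψ x₀ / ε)⌉₊ + 2 := by
  have h0 : R.sHat = 0 := Nat.le_zero.1 (R.sHat_le H hμ₀ hK hx₀ hgrowth (s := 0) hle)
  have ht := R.t_le_of_growth H hμ₀ hε hK hx₀ hgrowth (Nat.zero_le _) (s := 0) hle
  rw [numSteps, h0]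
  simp only [zero_add, Finset.range_one, Finset.sum_singleton, estimate]
  have := Nat.mul_le_mul_left (restartPeriod μ₀) ht
  rw [mul_comm (R.t 0)]
  omega

lemma numSteps_le (R : Execution f ψ L m ε μ₀ x₀) (H : IsComposite f ψ L) (hμ₀ : 0 < μ₀)
    (hμF : 0 < μF) (hε : 0 < ε) (hK : 1 ≤ restartPeriod μ₀) (hx₀ : x₀ ∈ effDom ψ)
    (hgrowth : QuadraticErrorBound f ψ L x₀ μF) {j : ℕ} (hj : estimate μ₀ j ≤ μF)
    (hlt : ∀ s < j, μF ≤ estimate μ₀ s) :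
    R.numSteps ≤ 1 + j + (∑ s ∈ Finset.range j, restartPeriod (estimate μ₀ s)) *
        max 1 ⌈Real.log (32 * gap f ψ x₀ / (ε * μF))⌉₊ +
      (restartPeriod (estimate μ₀ j) + 1) * max 1 ⌈Real.log (2 * gap f ψ x₀ / ε)⌉₊ := by
  have hsj := R.sHat_le H hμ₀ hK hx₀ hgrowth hj
  have hB := fun s (hs : s ≤ R.sHat) (hsj : s < j) =>
    R.t_le H hμ₀ hμF hε hK hx₀ hs (hlt s hsj)
  have hA := fun h : j ≤ R.sHat => R.t_le_of_growth H hμ₀ hε hK hx₀ hgrowth h hj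
  have hA1 := le_max_left 1 ⌈Real.log (2 * gap f ψ x₀ / ε)⌉₊
  generalize max 1 ⌈Real.log (32 * gap f ψ x₀ / (ε * μF))⌉₊ = B at hB ⊢
  generalize max 1 ⌈Real.log (2 * gap f ψ x₀ / ε)⌉₊ = A at hA hA1 ⊢
  have hsum : ∀ k ≤ j, k ≤ R.sHat + 1 →
      ∑ s ∈ Finset.range k, (R.t s * restartPeriod (estimate μ₀ s) + 1) ≤
        j + (∑ s ∈ Finset.range j, restartPeriod (estimate μ₀ s)) * B := by
    intro k hkj hkR
    calc ∑ s ∈ Finset.range k, (R.t s * restartPeriod (estimate μ₀ s) + 1)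
        ≤ ∑ s ∈ Finset.range k, (restartPeriod (estimate μ₀ s) * B + 1) := by
          refine Finset.sum_le_sum fun s hs => Nat.add_le_add_right ?_ 1
          rw [mul_comm]
          have := Finset.mem_range.1 hs
          exact Nat.mul_le_mul_left _ (hB s (by omega) (by omega))
      _ ≤ ∑ s ∈ Finset.range j, (restartPeriod (estimate μ₀ s) * B + 1) :=
          Finset.sum_le_sum_of_subset (Finset.range_mono hkj)
      _ = _ := by
          rw [Finset.sum_add_distrib, Finset.sum_mul]
          simp [add_comm]
  rw [numSteps]
  -- If the run ends before pass `j`, the earlier passes alone suffice. Otherwise the opening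
  -- proximal step of pass `j` is charged to `A ≥ 1`, which produces the factor K_j + 1.
  rcases hsj.lt_or_eq with h | h
  · have := hsum (R.sHat + 1) h le_rfl
    omega
  · have h1 := hsum j le_rfl (by omega)
    have h2 := Nat.mul_le_mul_left (restartPeriod (estimate μ₀ j)) (hA h.ge)
    rw [h, Finset.sum_range_succ, mul_comm (R.t j), add_mul, one_mul]
    omega

end Execution

end AdaRES

theorem mainTheorem3 {n : ℕ} (f : EuclideanSpace ℝ (Fin n) → ℝ)
    (ψ : EuclideanSpace ℝ (Fin n) → EReal) (L : Fin n → ℝ) (m : ℕ → ℕ → AdaRES.Scheme)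
    (ε μ₀ μF : ℝ) (x₀ : EuclideanSpace ℝ (Fin n))
    (hf_diff : Differentiable ℝ f) (hf_conv : ConvexOn ℝ Set.univ f)
    (hψ : AdaRES.ProperClosedConvex ψ)
    (hsol : (AdaRES.solutionSet f ψ).Nonempty)
    (hL : ∀ i, 0 < L i) (hsmooth : AdaRES.IsSmooth f L)
    (hx₀ : AdaRES.objective f ψ x₀ ≠ ⊤)
    (hμF : 0 < μF) (hgrowth : AdaRES.QuadraticErrorBound f ψ L x₀ μF)
    (hε : 0 < ε) (hμ₀ : 0 < μ₀) (hK : 1 ≤ AdaRES.restartPeriod μ₀) :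
    Nonempty (AdaRES.Execution f ψ L m ε μ₀ x₀) ∧
    ∀ R : AdaRES.Execution f ψ L m ε μ₀ x₀,
      (μ₀ ≤ μF →
        (R.numSteps : ℝ) ≤
          (⌈2 * Real.sqrt (Real.exp 1 / μ₀) - 1⌉ : ℝ) *
            max (1 : ℝ) (⌈Real.log (2 * AdaRES.gap f ψ x₀ / ε)⌉ : ℝ) + 2) ∧
      (μF < μ₀ →
        (R.numSteps : ℝ) ≤
          1 + (⌈Real.logb 2 (μ₀ / μF)⌉ : ℝ) +
            2 * Real.sqrt (Real.exp 1) / (Real.sqrt 2 - 1) *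
              (Real.sqrt (2 / μF) - Real.sqrt (1 / μ₀)) *
              max (1 : ℝ) (⌈Real.log (32 * AdaRES.gap f ψ x₀ / (ε * μF))⌉ : ℝ) +
            (⌈2 * Real.sqrt (2 * Real.exp 1) / Real.sqrt μF⌉ : ℝ) *
              max (1 : ℝ) (⌈Real.log (2 * AdaRES.gap f ψ x₀ / ε)⌉ : ℝ)) := by
  have H : AdaRES.IsComposite f ψ L := ⟨hf_diff, hf_conv, hψ, hsol, hL, hsmooth⟩
  have hxD : x₀ ∈ AdaRES.effDom ψ := AdaRES.IsComposite.mem_effDom_of_objective_ne_top hx₀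
  refine ⟨H.nonempty_execution hμ₀ hμF hε hK m hxD hgrowth, fun R => ⟨fun hle => ?_, fun hlt => ?_⟩⟩
  · have h := R.numSteps_le_of_le H hμ₀ hε hK hxD hgrowth hle
    rw [AdaRES.intCast_ceil_eq_restartPeriod hK, ← AdaRES.cast_max_one_natCeil]
    exact_mod_cast h
  · have hr : 1 < μ₀ / μF := (one_lt_div hμF).2 hlt
    obtain ⟨hj1, hj2⟩ := AdaRES.two_pow_natCeil_logb hr
    rw [← natCast_ceil_eq_intCast_ceil (Real.logb_pos one_lt_two hr).le]
    set j := ⌈Real.logb 2 (μ₀ / μF)⌉₊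
    have hj : AdaRES.estimate μ₀ j ≤ μF := by
      rw [AdaRES.estimate_eq, div_le_iff₀ (by positivity)]
      rwa [div_le_iff₀' hμF] at hj1
    have hj' : μF ≤ 2 * AdaRES.estimate μ₀ j := by
      rw [← mul_div_assoc, le_div_iff₀ hμF] at hj2
      rw [AdaRES.estimate_eq, ← mul_div_assoc, le_div_iff₀ (by positivity)]
      linarith
    -- Before `j` the estimate is at least `2 * estimate μ₀ j`, which is at least `μF`.
    have hs : ∀ s < j, μF ≤ AdaRES.estimate μ₀ s := by
      intro s hs
      have h1 := AdaRES.estimate_antitone hμ₀ (Nat.succ_le_of_lt hs)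
      have h2 : AdaRES.estimate μ₀ (s + 1) = AdaRES.estimate μ₀ s / 2 := rfl
      rw [h2] at h1
      linarith
    have hKj := hK.trans (AdaRES.restartPeriod_anti (AdaRES.estimate_pos hμ₀ j)
      (AdaRES.estimate_antitone hμ₀ j.zero_le))
    have h := R.numSteps_le H hμ₀ hμF hε hK hxD hgrowth hj hs
    have h' := (Nat.cast_le (α := ℝ)).2 h
    simp only [Nat.cast_add, Nat.cast_mul, Nat.cast_one, Nat.cast_sum,
      AdaRES.cast_max_one_natCeil] at h'
    refine h'.trans ?_
    gcongr
    · exact AdaRES.sum_restartPeriod_le hμ₀ hμF hj2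
    · exact AdaRES.restartPeriod_add_one_le hμF (AdaRES.estimate_pos hμ₀ j) hKj hj'
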